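/- **Setting.** Let $d\ge 1$, $b>0$, $q\ge 1$, $L_0>0$ and $1\le p\le\infty$ be fixed. One observes, for a noise level $\varepsilon\in(0,1)$, the process $X_\varepsilon=\{X_\varepsilon(g),\ g\in L_2(\mathbb R^d)\}$, $$X_\varepsilon(g)=\int_{\mathbb R^d} f(t)g(t)\,dt+\varepsilon\int_{\mathbb R^d} g\,dW ,$$ where $W$ is Gaussian white noise on $\mathbb R^d$ with Lebesgue intensity, i.e. $(\int g\,dW)_{g\in L_2}$ is a centred Gaussian process with covariance $\int gh$. An estimator $\tilde f_\varepsilon$ is an $X_\varepsilon$-measurable Borel function on $\mathbb R^d$ belonging to $L_p(\mathbb R^d)$; with $\|\cdot\|_p$ the $L_p$-norm on $(-b,b)^d$ (the supremum of the absolute value if $p=\infty$), its risk is $\mathcal R_\varepsilon^{(p)}[\tilde f_\varepsilon;f]=\{\mathbb E_f\|\tilde f_\varepsilon-f\|_p^q\}^{1/q}$. For $\vec\beta\in(0,\infty)^d$, $\vec r\in[1,\infty]^d$, $\vec L\in(0,\infty)^d$ the anisotropic Nikolskii class $\mathbb N_{\vec r,d}(\vec\beta,\vec L)$ is the set of Borel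 functions $g\in L_2(\mathbb R^d)$ such that, for every $j=1,\dots,d$, $\|g\|_{L_{r_j}(\mathbb R^d)}\le L_j$ and there is a natural number $k_j>\beta_j$ with $\|\Delta^{k_j}_{u,j}g\|_{L_{r_j}(\mathbb R^d)}\le L_j|u|^{\beta_j}$ for all $u\in\mathbb R$, where $\Delta_{u,j}g(x)=g(x+u\mathbf e_j)-g(x)$ and $\Delta^k_{u,j}$ is its $k$-th iterate. Let $\mathbb F=\mathbb F_p(\vec\beta,\vec r,\vec L)$ be the set of those $f\in \mathbb N_{\vec r,d}(\vec\beta,\vec L)$ that belong to $L_p(\mathbb R^d)$ and vanish outside $(-b,b)^d$. Put $\frac1\beta=\sum_j\frac1{\beta_j}$, $\frac1\omega=\sum_j\frac1{\beta_jr_j}$, $L_\beta=\prod_jL_j^{1/\beta_j}$, $p^*=\max(r_1,\dots,r_d,p)$ and, for $1\le s\le\infty$, $$\tau(s)=1-\frac1\omega+\frac1{s\beta},\qquad \kappa(s)=\omega\Big(2+\frac1\beta\Big)-s,$$ with $1/\infty=0$, $\kappa(\infty)=-\infty$, and $\kappa(s)=+\infty$ if $\omega=\infty$, $s<\infty$.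 Define $$\mathfrak a=\begin{cases}\frac{\beta}{2\beta+1},&\kappa(p)>0,\\ \frac{\tau(p)}{2\tau(2)},&\kappa(p)\le0,\ \tau(p^*)>0,\\ \frac{\omega(p^*-p)}{p\,(p^*-\omega(2+1/\beta))},&\kappa(p)\le0,\ \tau(p^*)\le0,\ p^*>p,\\ 0,&\kappa(p)\le0,\ \tau(p^*)\le0,\ p^*=p,\end{cases}$$ (the third expression is read as its limit $\omega/p$ if $p^*=\infty$) and $$\delta_\varepsilon=\begin{cases}L_\beta\varepsilon^2,&\kappa(p)>0,\\ L_\beta\varepsilon^2|\ln\varepsilon|,&\kappa(p)\le0,\ \tau(p^*)\le0,\\ L_\beta^{\frac{1-2/p}{\tau(p)}}\varepsilon^2|\ln\varepsilon|,&\kappa(p)\le0,\ \tau(p^*)>0.\end{cases}$$ **Theorem.** For all $\vec\beta\in(0,\infty)^d$ and $\vec r\in[1,\infty]^d$ there is a constant $c>0$ such that for every $\vec L\in[L_0,\infty)^d$ $$\liminf_{\varepsilon\to0}\ \inf_{\tilde f_\varepsilon}\ \sup_{f\in\mathbb F_p(\vec\beta,\vec r,\vec L)}\delta_\varepsilon^{-\mathfrak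 a}\,\mathcal R^{(p)}_\varepsilon[\tilde f_\varepsilon;f]\ \ge\ c ,$$ the infimum being over all estimators; $c$ does not depend on $\vec L$. In particular, if $p^*=p$ and $\tau(p)\mathbf 1_{p\ge2}+\kappa(p)\mathbf 1_{p<2}\le0$, there is no uniformly consistent estimator: for every $\vec L\in[L_0,\infty)^d$ there is no family of estimators $(\tilde f_\varepsilon)$ with $\sup_{f\in\mathbb F_p(\vec\beta,\vec r,\vec L)}\mathcal R_\varepsilon^{(p)}[\tilde f_\varepsilon;f]\to0$ as $\varepsilon\to0$. -/

import Mathlib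

open MeasureTheory ProbabilityTheory Filter Topology
open scoped ENNReal

noncomputable section

namespace MinimaxNikolskii

/-! ### Norms, differences and the anisotropic Nikolskii classes -/

/-- The `L_p`-norm over `A ⊆ ℝ^d` with respect to Lebesgue measure for `p < ∞`, and the supremum of
`|g|` over `A` for `p = ∞`, as a value in `[0, ∞]`. -/
def normLp {d : ℕ} (p : ℝ≥0∞) (A : Set (Fin d → ℝ)) (g : (Fin d → ℝ) → ℝ) : ℝ≥0∞ :=
  if p = ∞ then ⨆ t ∈ A, ENNReal.ofReal |g t| else eLpNorm g p (volume.restrict A)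

/-- Borel functions on `ℝ^d` whose `L_p(ℝ^d)`-norm is finite. -/
def InLp {d : ℕ} (p : ℝ≥0∞) (g : (Fin d → ℝ) → ℝ) : Prop :=
  Measurable g ∧ normLp p Set.univ g < ∞

/-- The open cube `(-b, b)^d`. -/
def cube (d : ℕ) (b : ℝ) : Set (Fin d → ℝ) :=
  {x | ∀ i, -b < x i ∧ x i < b}

/-- The `k`-th order difference operator with step size `u` in the direction of the variable `x_j`:
the `k`-fold iterate of `g ↦ (x ↦ g (x + u e_j) - g x)`. -/
def diffOp {d : ℕ} (k : ℕ) (u : ℝ) (j : Fin d) (g : (Fin d → ℝ) → ℝ) : (Fin d → ℝ) → ℝ :=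
  (fwdDiff (Pi.single j u))^[k] g

/-- The anisotropic Nikolskii class (before intersection with `L_2`). -/
def nikolskiiBar {d : ℕ} (r : Fin d → ℝ≥0∞) (β L : Fin d → ℝ) : Set ((Fin d → ℝ) → ℝ) :=
  {g | Measurable g ∧
    (∀ j, normLp (r j) Set.univ g ≤ ENNReal.ofReal (L j)) ∧
    (∀ j, ∃ k : ℕ, β j < k ∧ ∀ u : ℝ,
      normLp (r j) Set.univ (diffOp k u j g) ≤ ENNReal.ofReal (L j * |u| ^ β j))}

/-- The anisotropic Nikolskii class: its elements are moreover square integrable. -/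
def nikolskii {d : ℕ} (r : Fin d → ℝ≥0∞) (β L : Fin d → ℝ) : Set ((Fin d → ℝ) → ℝ) :=
  nikolskiiBar r β L ∩ {g | InLp 2 g}

/-- The signals of the Nikolskii class for which the `L_p`-risk on `(-b, b)^d` is considered:
they belong to `L_p` and vanish outside `(-b, b)^d`. -/
def signals {d : ℕ} (b : ℝ) (p : ℝ≥0∞) (r : Fin d → ℝ≥0∞) (β L : Fin d → ℝ) :
    Set ((Fin d → ℝ) → ℝ) :=
  nikolskii r β L ∩ {g | InLp p g ∧ ∀ x, x ∉ cube d b → g x = 0}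

/-! ### The Gaussian white noise model, estimators and risks -/

/-- The Hilbert space `L_2(ℝ^d, ν_d)` of (classes of) test functions. -/
abbrev TestSpace (d : ℕ) : Type := Lp ℝ 2 (volume : Measure (Fin d → ℝ))

/-- The space of observations `(X(g))_{g ∈ L_2}`, with the product `σ`-algebra. -/
abbrev Obs (d : ℕ) : Type := TestSpace d → ℝ

/-- `W` is the white noise on `ℝ^d` with Lebesgue intensity, given by its stochastic integrals
`W g = ∫ g dW`, `g ∈ L_2`: a centred Gaussian process with covariance `∫ g h dν`
(so `W(B)` is the value at the indicator function of `B`). -/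
structure IsWhiteNoise {Ω : Type*} [MeasurableSpace Ω] {d : ℕ}
    (W : TestSpace d → Ω → ℝ) (P : Measure Ω) : Prop where
  measurable : ∀ g, Measurable (W g)
  gaussian : IsGaussianProcess W P
  mean : ∀ g, ∫ x, W g x ∂P = 0
  covariance : ∀ g h, ∫ x, W g x * W h x ∂P = ∫ t, g t * h t

/-- The observation `X_ε(g) = ∫ f g dν + ε ∫ g dW`. -/
def observation {Ω : Type*} {d : ℕ} (W : TestSpace d → Ω → ℝ) (ε : ℝ) (f : (Fin d → ℝ) → ℝ)
    (x : Ω) : Obs d :=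
  fun g => (∫ t, f t * g t) + ε * W g x

/-- An estimator: a function of the observation, jointly measurable in the observation and in the
point of `ℝ^d`, with values in `L_p(ℝ^d)`. -/
def IsEstimator {d : ℕ} (p : ℝ≥0∞) (T : Obs d → (Fin d → ℝ) → ℝ) : Prop :=
  Measurable (Function.uncurry T) ∧ ∀ X, InLp p (T X)

/-- The `L_p`-risk `(E_f ‖T(X_ε) - f‖_p^q)^{1/q}`, the norm being taken over `(-b, b)^d`. -/
def risk {Ω : Type*} [MeasurableSpace Ω] {d : ℕ} (W : TestSpace d → Ω → ℝ) (P : Measure Ω)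
    (b : ℝ) (p : ℝ≥0∞) (q ε : ℝ) (T : Obs d → (Fin d → ℝ) → ℝ) (f : (Fin d → ℝ) → ℝ) : ℝ≥0∞ :=
  (∫⁻ x, normLp p (cube d b) (fun t => T (observation W ε f x) t - f t) ^ q ∂P) ^ (1 / q)

/-! ### The parameters of the class and the rate -/

/-- `1/β = ∑_j 1/β_j`. -/
def invBeta {d : ℕ} (β : Fin d → ℝ) : ℝ := ∑ j, 1 / β j

/-- `1/ω = ∑_j 1/(β_j r_j)`, with `1/∞ = 0`. -/
def invOmega {d : ℕ} (β : Fin d → ℝ) (r : Fin d → ℝ≥0∞) : ℝ := ∑ j, 1 / β j * (r j)⁻¹.toReal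

/-- `ω ∈ (0, ∞]`; it is `∞` exactly when all `r_j` are. -/
def omega {d : ℕ} (β : Fin d → ℝ) (r : Fin d → ℝ≥0∞) : ℝ≥0∞ := (ENNReal.ofReal (invOmega β r))⁻¹

/-- `L_β = ∏_j L_j^{1/β_j}`. -/
def prodL {d : ℕ} (β L : Fin d → ℝ) : ℝ := ∏ j, L j ^ (1 / β j)

/-- `τ(s) = 1 - 1/ω + 1/(sβ)`, with `1/∞ = 0`. -/
def tau {d : ℕ} (β : Fin d → ℝ) (r : Fin d → ℝ≥0∞) (s : ℝ≥0∞) : ℝ :=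
  1 - invOmega β r + s⁻¹.toReal * invBeta β

/-- `κ(s) = ω(2 + 1/β) - s`, an extended real number. It is `-∞` for `s = ∞` (also if `ω = ∞`, the
convention of `EReal` being `∞ - ∞ = -∞`), and `+∞` if `ω = ∞` and `s < ∞`. -/
def kappa {d : ℕ} (β : Fin d → ℝ) (r : Fin d → ℝ≥0∞) (s : ℝ≥0∞) : EReal :=
  (omega β r : EReal) * ((2 + invBeta β : ℝ) : EReal) - (s : EReal)

/-- `p* = max(max_j r_j, p)`. -/
def pstar {d : ℕ} (r : Fin d → ℝ≥0∞) (p : ℝ≥0∞) : ℝ≥0∞ := (⨆ j, r j) ⊔ p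

/-- The exponent of the sparse zone with `p* > p`: `ω(p* - p) / (p (p* - ω(2 + 1/β)))`, which is
`ω / p` (the limit) for `p* = ∞`. -/
def sparseExponent {d : ℕ} (β : Fin d → ℝ) (r : Fin d → ℝ≥0∞) (p : ℝ≥0∞) : ℝ :=
  if pstar r p = ∞ then (omega β r).toReal / p.toReal
  else (omega β r).toReal * ((pstar r p).toReal - p.toReal) /
    (p.toReal * ((pstar r p).toReal - (omega β r).toReal * (2 + invBeta β)))

/-- The exponent `𝔞` of the rate. In the first zone, `β / (2β + 1)` with `β = 1 / (1/β)`. -/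
def rateExponent {d : ℕ} (β : Fin d → ℝ) (r : Fin d → ℝ≥0∞) (p : ℝ≥0∞) : ℝ :=
  if 0 < kappa β r p then (1 / invBeta β) / (2 * (1 / invBeta β) + 1)
  else if 0 < tau β r (pstar r p) then tau β r p / (2 * tau β r 2)
  else if p < pstar r p then sparseExponent β r p
  else 0

/-- The quantity `δ_ε`. -/
def rateBase {d : ℕ} (β : Fin d → ℝ) (r : Fin d → ℝ≥0∞) (L : Fin d → ℝ) (p : ℝ≥0∞) (ε : ℝ) : ℝ :=
  if 0 < kappa β r p then prodL β L * ε ^ 2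
  else if 0 < tau β r (pstar r p) then
    prodL β L ^ ((1 - 2 * p⁻¹.toReal) / tau β r p) * ε ^ 2 * |Real.log ε|
  else prodL β L * ε ^ 2 * |Real.log ε|

end MinimaxNikolskii

end

namespace MinimaxNikolskii

/-! ### Product measures -/

/-! The bound is Bayesian. Choose `S * N` disjoint congruent cells in the cube, arranged in `S`
blocks of `N`. A word `θ : Fin S → Fin N` selects one cell per block, and its signal is the sum of
smooth bumps of height `A` on the selected cells. Two such signals are at `L_p`-distance at least a
constant times `A (S V)^(1/p)` times the proportion of blocks where the words differ, `V` being the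
volume of a cell. If `exp (A² V / ε²) ≤ 3N/4`, the chi-square bound makes the `N` positions in a
block hard to tell apart: under the uniform prior every decision is wrong in a block with
probability at least `1/8` (`bayes_lower_bound`). The normalized bumps form an orthonormal system,
so the observation splits into independent shifted Gaussians and a residual noise whose law does not
depend on the word (`IsWhiteNoise.exists_lintegral_ge`). Hence some signal has risk of order `A (S
V)^(1/p)` (`iSup_risk_ge`). What remains is to choose parameters. With `σ` the active volume `S V`
up to a factor 2, smoothness imposes `h_j^(β_j) ≍ A σ^(1/r_j) / L_j`, which fixes `V`, while `N ≍
b^d / σ`. Only `A` and `σ` stay free, and `exists_minimaxBound` gives the bound `A σ^(1/p)` under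
the constraints gathered in `Admissible`. The zones correspond to four choices: `σ` constant (dense
zone); `σ` comparable with `V`, hence a bounded number of bumps (sparse, `τ(p*) > 0`); `A = a
σ^(-1/p*)` with `σ` a power of `L_β ε² |ln ε|` (sparse, `τ(p*) ≤ 0`, `p* > p`); the same `A` with
`σ` as small as needed at fixed `ε` (`p* = p`), where the bound does not tend to zero. -/

theorem lintegral_pi_prod {ι : Type*} [Fintype ι] {Y : ι → Type*} [∀ i, MeasurableSpace (Y i)]
    (μ : ∀ i, Measure (Y i)) [∀ i, IsProbabilityMeasure (μ i)] (f : ∀ i, Y i → ℝ≥0∞)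
    (hf : ∀ i, Measurable (f i)) :
    ∫⁻ y, ∏ i, f i (y i) ∂Measure.pi μ = ∏ i, ∫⁻ y, f i y ∂μ i := by
  have h := lintegral_prod_eq_prod_lintegral_of_indepFun (μ := Measure.pi μ) Finset.univ
    (fun i (y : ∀ i, Y i) => f i (y i)) (iIndepFun_pi fun i => (hf i).aemeasurable)
    (fun i => (hf i).comp (measurable_pi_apply i))
  rw [h]
  refine Finset.prod_congr rfl fun i _ => ?_
  rw [← (measurePreserving_eval μ i).lintegral_comp (hf i)]

theorem pi_withDensity {ι : Type*} [Fintype ι] {Y : ι → Type*} [∀ i, MeasurableSpace (Y i)]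
    (μ : ∀ i, Measure (Y i)) [∀ i, IsProbabilityMeasure (μ i)] (f : ∀ i, Y i → ℝ≥0∞)
    (hf : ∀ i, Measurable (f i)) (hf1 : ∀ i, ∫⁻ y, f i y ∂μ i = 1) :
    Measure.pi (fun i => (μ i).withDensity (f i)) =
      (Measure.pi μ).withDensity fun y => ∏ i, f i (y i) := by
  have : ∀ i, IsProbabilityMeasure ((μ i).withDensity (f i)) := fun i =>
    ⟨by rw [withDensity_apply _ MeasurableSet.univ, Measure.restrict_univ, hf1]⟩
  refine Measure.pi_eq fun s hs => ?_
  rw [withDensity_apply _ (MeasurableSet.univ_pi hs), ← lintegral_indicator (MeasurableSet.univ_pi hs)]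
  have : ∀ y : ∀ i, Y i, (Set.univ.pi s).indicator (fun y => ∏ i, f i (y i)) y =
      ∏ i, (s i).indicator (f i) (y i) := by
    intro y
    by_cases hy : y ∈ Set.univ.pi s
    · rw [Set.indicator_of_mem hy]
      exact Finset.prod_congr rfl fun i _ => (Set.indicator_of_mem (hy i trivial) _).symm
    · rw [Set.indicator_of_notMem hy]
      simp only [Set.mem_pi, Set.mem_univ, true_implies, not_forall] at hy
      obtain ⟨i, hi⟩ := hy
      exact (Finset.prod_eq_zero (Finset.mem_univ i) (Set.indicator_of_notMem hi _)).symm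
  simp_rw [this]
  rw [lintegral_pi_prod μ _ fun i => (hf i).indicator (hs i)]
  refine Finset.prod_congr rfl fun i _ => ?_
  rw [lintegral_indicator (hs i), withDensity_apply _ (hs i)]

/-! ### The Bayes risk of the identification of one of `N` hypotheses in each of `S` blocks -/

/-- This is `(x - n)² ≥ 0`. Applied to likelihood ratios, it bounds the largest of `N` of them
through the sum of their squares, so second moments suffice and no truncation is needed. -/
theorem ennreal_le_sq_add {x : ℝ≥0∞} {n : ℕ} (hn : 0 < n) :
    x ≤ (2 * (n : ℝ≥0∞))⁻¹ * x ^ 2 + n / 2 := by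
  rcases eq_or_ne x ∞ with rfl | hx
  · have : (2 * (n : ℝ≥0∞))⁻¹ ≠ 0 := by simp [ENNReal.mul_eq_top]
    simp [ENNReal.mul_top this]
  lift x to NNReal using hx
  have h0 : (2 * (n : NNReal)) ≠ 0 := by positivity
  have : ((2 * (n : ℝ≥0∞))⁻¹ * (x : ℝ≥0∞) ^ 2 + n / 2) =
      (((2 * (n : NNReal))⁻¹ * x ^ 2 + n / 2 : NNReal) : ℝ≥0∞) := by
    push_cast [ENNReal.coe_inv h0, ENNReal.coe_div]
    simp
  rw [this, ENNReal.coe_le_coe, ← NNReal.coe_le_coe]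
  push_cast
  have hn' : (0 : ℝ) < n := by exact_mod_cast hn
  have : (2 * (n : ℝ))⁻¹ * (x : ℝ) ^ 2 + n / 2 - x = (x - n) ^ 2 / (2 * n) := by
    field_simp; ring
  have : 0 ≤ ((x : ℝ) - n) ^ 2 / (2 * n) := by positivity
  linarith

/-- The number of coordinates in which two words differ. -/
def hamming {S N : ℕ} (θ θ' : Fin S → Fin N) : ℕ := (Finset.univ.filter fun s => θ s ≠ θ' s).card

theorem hamming_eq_sum {S N : ℕ} (θ θ' : Fin S → Fin N) :
    (hamming θ θ' : ℝ≥0∞) = ∑ s, if θ s ≠ θ' s then 1 else 0 := by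
  simp [hamming, Finset.sum_ite]

/-- Expand the product over all words and separate those that agree with `θ₀` at `s`. Their sum
factorizes, with the single likelihood `l s (θ₀ s)` as factor `s`; the quadratic bound replaces it
by a quantity free of `θ₀`, which allows `θ₀` to depend on the data later. -/
theorem sum_prod_le {S N : ℕ} (hN : 0 < N) (l : Fin S → Fin N → ℝ≥0∞) (θ₀ : Fin S → Fin N)
    (s : Fin S) :
    ∏ t, ∑ k, l t k ≤ (∑ θ : Fin S → Fin N, (∏ t, l t (θ t)) * if θ s ≠ θ₀ s then 1 else 0) +
      ∏ t, Function.update (fun t => ∑ k, l t k) s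
        ((2 * (N : ℝ≥0∞))⁻¹ * ∑ k, l s k ^ 2 + N / 2) t := by
  have h1 : ∀ θ : Fin S → Fin N, ∏ t, l t (θ t) =
      (∏ t, l t (θ t)) * (if θ s ≠ θ₀ s then 1 else 0) +
      ∏ t, (if t = s then (if θ t = θ₀ t then l t (θ t) else 0) else l t (θ t)) := by
    intro θ
    by_cases h : θ s = θ₀ s
    · simp only [h, ne_eq, not_true_eq_false, if_false, mul_zero, zero_add]
      refine Finset.prod_congr rfl fun t _ => ?_
      by_cases ht : t = s
      · subst ht; simp [h]
      · simp [ht]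
    · simp only [ne_eq, h, not_false_eq_true, if_true, mul_one]
      rw [Finset.prod_eq_zero (f := fun t => if t = s then _ else _) (Finset.mem_univ s)
        (by simp [h]), add_zero]
  have h2 : ∏ t, ∑ k, l t k = ∑ θ : Fin S → Fin N, ∏ t, l t (θ t) := by
    rw [Finset.prod_univ_sum]; simp
  rw [h2, Finset.sum_congr rfl fun θ _ => h1 θ, Finset.sum_add_distrib]
  gcongr
  have h3 : ∑ θ : Fin S → Fin N,
      ∏ t, (if t = s then (if θ t = θ₀ t then l t (θ t) else 0) else l t (θ t)) =
      ∏ t, ∑ k, (if t = s then (if k = θ₀ t then l t k else 0) else l t k) := by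
    rw [Finset.prod_univ_sum]; simp
  rw [h3]
  refine Finset.prod_le_prod' fun t _ => ?_
  by_cases ht : t = s
  · subst ht
    simp only [if_true, Finset.sum_ite_eq', Finset.mem_univ, Function.update_self]
    refine (ennreal_le_sq_add hN).trans ?_
    gcongr
    exact Finset.single_le_sum (f := fun k => l t k ^ 2) (fun _ _ => zero_le) (Finset.mem_univ _)
  · simp [ht]

/-- Compare with the word `θ₀` that minimizes `F · y`: then `a * hamming θ θ₀ / S ≤ 2 * F θ y`, so
`F` is bounded below by a posterior error count. In each block the integrated likelihood of the
correct guesses is at most `7/8` of the total, and half of the remaining eighth gives `a / 16`. -/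
theorem bayes_lower_bound {Y : Type*} [MeasurableSpace Y] (μ : Measure Y) [IsProbabilityMeasure μ]
    {S N : ℕ} (hS : 0 < S) (hN : 0 < N) (l : Fin N → Y → ℝ≥0∞) (hl : ∀ i, Measurable (l i))
    (hl1 : ∀ i, ∫⁻ y, l i y ∂μ = 1) (hl2 : ∀ i, ∫⁻ y, l i y ^ 2 ∂μ ≤ 3 / 4 * N)
    (F : (Fin S → Fin N) → (Fin S → Y) → ℝ≥0∞) (hF : ∀ θ, Measurable (F θ)) (a : ℝ≥0∞) (ha : a ≠ ∞)
    (haF : ∀ θ θ' y, a * (hamming θ θ' / S) ≤ F θ y + F θ' y) :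
    a / 16 * N ^ S ≤
      ∑ θ, ∫⁻ y, F θ y ∂Measure.pi (fun s => μ.withDensity (l (θ s))) := by
  have hSE : (S : ℝ≥0∞) ≠ 0 := by exact_mod_cast hS.ne'
  have hNE : (N : ℝ≥0∞) ≠ 0 := by exact_mod_cast hN.ne'
  set U : Y → ℝ≥0∞ := fun y => ∑ k, l k y with hU
  set G : Y → ℝ≥0∞ := fun y => (2 * (N : ℝ≥0∞))⁻¹ * ∑ k, l k y ^ 2 + N / 2 with hG
  have hUm : Measurable U := Finset.measurable_fun_sum _ fun k _ => hl k
  have hGm : Measurable G := by fun_prop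
  have hUi : ∫⁻ y, U y ∂μ = N := by
    rw [hU, lintegral_finsetSum _ fun k _ => hl k]; simp [hl1]
  -- `7/8 = (1/2)(3/4) + 1/2`: the chi-square bound enters here, and any constant below 1 in place
  -- of `3/4` would leave a gap.
  have hGi : ∫⁻ y, G y ∂μ ≤ 7 / 8 * N := by
    rw [hG, lintegral_add_right _ measurable_const, lintegral_const_mul _ (by fun_prop),
      lintegral_finsetSum _ (fun k _ => (hl k).pow_const 2)]
    simp only [lintegral_const, measure_univ, mul_one]
    have : ∑ k, ∫⁻ y, l k y ^ 2 ∂μ ≤ N * (3 / 4 * N) := by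
      refine (Finset.sum_le_sum fun k _ => hl2 k).trans ?_
      simp
    calc (2 * (N : ℝ≥0∞))⁻¹ * ∑ k, ∫⁻ y, l k y ^ 2 ∂μ + N / 2
        ≤ (2 * (N : ℝ≥0∞))⁻¹ * (N * (3 / 4 * N)) + N / 2 := by gcongr
      _ = 7 / 8 * N := by
        have e1 : (N : ℝ≥0∞) = ENNReal.ofReal N := by simp
        have hN' : (0 : ℝ) < N := by exact_mod_cast hN
        have e2 : (2 : ℝ≥0∞) = ENNReal.ofReal 2 := by simp
        have e3 : (3 / 4 : ℝ≥0∞) = ENNReal.ofReal (3 / 4) := by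
          rw [ENNReal.ofReal_div_of_pos (by norm_num)]; simp
        have e4 : (7 / 8 : ℝ≥0∞) = ENNReal.ofReal (7 / 8) := by
          rw [ENNReal.ofReal_div_of_pos (by norm_num)]; simp
        rw [e3, e4, e1, e2, ← ENNReal.ofReal_mul (by norm_num), ← ENNReal.ofReal_inv_of_pos (by positivity),
          ← ENNReal.ofReal_mul (by norm_num), ← ENNReal.ofReal_mul (by positivity),
          ← ENNReal.ofReal_mul (by positivity), ← ENNReal.ofReal_div_of_pos (by norm_num),
          ← ENNReal.ofReal_add (by positivity) (by positivity), ← ENNReal.ofReal_mul (by positivity)]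
        congr 1
        field_simp
        norm_num
  set Z : (Fin S → Y) → ℝ≥0∞ := fun y => ∏ s, U (y s)
  set B : Fin S → (Fin S → Y) → ℝ≥0∞ := fun s y =>
    ∏ t, Function.update (fun _ => U) s G t (y t)
  have hBm' : ∀ s t, Measurable (Function.update (fun _ : Fin S => U) s G t) := by
    intro s t
    by_cases h : t = s
    · subst h; simpa using hGm
    · simpa [h] using hUm
  have hZi : ∫⁻ y, Z y ∂Measure.pi (fun _ : Fin S => μ) = N ^ S := by
    rw [lintegral_pi_prod (fun _ : Fin S => μ) (fun _ => U) fun _ => hUm]; simp [hUi]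
  have hBi : ∀ s, ∫⁻ y, B s y ∂Measure.pi (fun _ : Fin S => μ) ≤ 7 / 8 * N ^ S := by
    intro s
    rw [lintegral_pi_prod (fun _ : Fin S => μ) _ (hBm' s)]
    rw [← Finset.mul_prod_erase _ _ (Finset.mem_univ s)]
    simp only [Function.update_self]
    have : ∏ t ∈ Finset.univ.erase s, ∫⁻ y, Function.update (fun _ : Fin S => U) s G t y ∂μ =
        (N : ℝ≥0∞) ^ (S - 1) := by
      rw [Finset.prod_congr rfl (g := fun _ => (N : ℝ≥0∞))]
      · simp
      · intro t ht
        rw [Function.update_of_ne (Finset.ne_of_mem_erase ht), hUi]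
    rw [this]
    calc (∫⁻ y, G y ∂μ) * (N : ℝ≥0∞) ^ (S - 1) ≤ 7 / 8 * N * (N : ℝ≥0∞) ^ (S - 1) := by gcongr
      _ = 7 / 8 * N ^ S := by
        rw [mul_assoc, ← pow_succ', Nat.sub_add_cancel hS]
  -- The minimizing word depends on `y`, but the inequality no longer contains it, so no measurable
  -- selection is required before integrating.
  have hpoint : ∀ y : Fin S → Y, a / 2 * Z y ≤
      (∑ θ, (∏ s, l (θ s) (y s)) * F θ y) + a / (2 * S) * ∑ s, B s y := by
    intro y
    have : Nonempty (Fin S → Fin N) := ⟨fun _ => ⟨0, hN⟩⟩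
    obtain ⟨θ₀, -, hθ₀⟩ := Finset.exists_min_image Finset.univ (fun θ => F θ y)
      Finset.univ_nonempty
    have hFl : ∀ θ, a / (2 * S) * hamming θ θ₀ ≤ F θ y := by
      intro θ
      have h2 : a * (hamming θ θ₀ / S) ≤ 2 * F θ y := by
        rw [two_mul]
        exact (haF θ θ₀ y).trans (by gcongr; exact hθ₀ θ (Finset.mem_univ _))
      have : a / (2 * S) * hamming θ θ₀ = (a * (hamming θ θ₀ / S)) / 2 := by
        simp only [div_eq_mul_inv]
        rw [ENNReal.mul_inv (by simp) (by simp)]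
        ring
      rw [this]
      exact ENNReal.div_le_of_le_mul (by rwa [mul_comm (F θ y)])
    have hk : ∀ s, Z y ≤ (∑ θ : Fin S → Fin N, (∏ t, l (θ t) (y t)) *
        if θ s ≠ θ₀ s then 1 else 0) + B s y := by
      intro s
      refine (sum_prod_le hN (fun t k => l k (y t)) θ₀ s).trans (le_of_eq ?_)
      congr 1
      refine Finset.prod_congr rfl fun t _ => ?_
      by_cases h : t = s
      · subst h; simp [hG]
      · simp [h, hU]
    have hsum : S * Z y ≤ (∑ θ : Fin S → Fin N, (∏ t, l (θ t) (y t)) * hamming θ θ₀) +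
        ∑ s, B s y := by
      have := Finset.sum_le_sum fun s (_ : s ∈ Finset.univ) => hk s
      rw [Finset.sum_add_distrib, Finset.sum_comm] at this
      simp only [← Finset.mul_sum, ← hamming_eq_sum] at this
      simpa using this
    calc a / 2 * Z y = a / (2 * S) * (S * Z y) := by
          rw [← mul_assoc]
          congr 1
          simp only [div_eq_mul_inv]
          rw [ENNReal.mul_inv (by simp) (by simp), mul_assoc, mul_assoc,
            ENNReal.inv_mul_cancel hSE (by simp), mul_one]
      _ ≤ a / (2 * S) * ((∑ θ : Fin S → Fin N, (∏ t, l (θ t) (y t)) * hamming θ θ₀) +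
        ∑ s, B s y) := by gcongr
      _ = (∑ θ : Fin S → Fin N, (∏ t, l (θ t) (y t)) * (a / (2 * S) * hamming θ θ₀)) +
        a / (2 * S) * ∑ s, B s y := by
          rw [mul_add, Finset.mul_sum]
          congr 1
          exact Finset.sum_congr rfl fun θ _ => by ring
      _ ≤ _ := by
          gcongr with θ
          exact hFl θ
  have hlm : ∀ θ : Fin S → Fin N, Measurable fun y : Fin S → Y => ∏ s, l (θ s) (y s) := fun θ =>
    Finset.measurable_fun_prod _ fun s _ => (hl _).comp (measurable_pi_apply s)
  have hBm : ∀ s, Measurable (B s) := fun s =>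
    Finset.measurable_fun_prod _ fun t _ => (hBm' s t).comp (measurable_pi_apply t)
  have hZm : Measurable Z := Finset.measurable_fun_prod _ fun s _ => hUm.comp (measurable_pi_apply s)
  have hint : a / 2 * N ^ S ≤
      (∑ θ, ∫⁻ y, F θ y ∂Measure.pi (fun s => μ.withDensity (l (θ s)))) + a / 2 * (7 / 8 * N ^ S) := by
    calc a / 2 * N ^ S = ∫⁻ y, a / 2 * Z y ∂Measure.pi (fun _ : Fin S => μ) := by
          rw [lintegral_const_mul _ hZm, hZi]
      _ ≤ ∫⁻ y, ((∑ θ, (∏ s, l (θ s) (y s)) * F θ y) + a / (2 * S) * ∑ s, B s y)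
            ∂Measure.pi (fun _ : Fin S => μ) := lintegral_mono hpoint
      _ = (∑ θ, ∫⁻ y, F θ y ∂Measure.pi (fun s => μ.withDensity (l (θ s)))) +
          a / (2 * S) * ∑ s, ∫⁻ y, B s y ∂Measure.pi (fun _ : Fin S => μ) := by
          have hLF : ∀ θ : Fin S → Fin N, Measurable fun y : Fin S → Y =>
              (∏ s, l (θ s) (y s)) * F θ y := fun θ => (hlm θ).mul (hF θ)
          rw [lintegral_add_left (Finset.measurable_fun_sum _ fun θ _ => hLF θ),
            lintegral_finsetSum _ (fun θ _ => hLF θ),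
            lintegral_const_mul _ (Finset.measurable_fun_sum _ fun s _ => hBm s),
            lintegral_finsetSum _ (fun s _ => hBm s)]
          congr 1
          refine Finset.sum_congr rfl fun θ _ => ?_
          rw [pi_withDensity (fun _ : Fin S => μ) (fun s => l (θ s)) (fun s => hl _) (fun s => hl1 _),
            lintegral_withDensity_eq_lintegral_mul _ (hlm θ) (hF θ)]
          rfl
      _ ≤ (∑ θ, ∫⁻ y, F θ y ∂Measure.pi (fun s => μ.withDensity (l (θ s)))) +
          a / (2 * S) * ∑ s : Fin S, (7 / 8 * (N : ℝ≥0∞) ^ S) := by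
          gcongr with s; exact hBi s
      _ = _ := by
          congr 1
          simp only [Finset.sum_const, Finset.card_univ, Fintype.card_fin, nsmul_eq_mul]
          rw [← mul_assoc]
          congr 1
          simp only [div_eq_mul_inv]
          rw [ENNReal.mul_inv (by simp) (by simp), mul_assoc, mul_assoc,
            ENNReal.inv_mul_cancel hSE (by simp), mul_one]
  · have hfin : a / 2 * (7 / 8 * (N : ℝ≥0∞) ^ S) ≠ ∞ := by
      refine ENNReal.mul_ne_top (ENNReal.div_ne_top ha (by simp)) (ENNReal.mul_ne_top ?_ (by simp))
      exact ENNReal.div_ne_top (by simp) (by simp)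
    have hsplit : a / 2 * (N : ℝ≥0∞) ^ S = a / 16 * N ^ S + a / 2 * (7 / 8 * N ^ S) := by
      lift a to NNReal using ha
      have : ((1 : ℝ≥0∞) / 2) = 1 / 16 + 1 / 2 * (7 / 8) := by
        rw [← ENNReal.toReal_eq_toReal_iff' (by simp) (by finiteness)]
        rw [ENNReal.toReal_add (by finiteness) (by finiteness)]
        simp; norm_num
      calc (a : ℝ≥0∞) / 2 * (N : ℝ≥0∞) ^ S = a * (1 / 2) * N ^ S := by simp [div_eq_mul_inv]
        _ = a * (1 / 16 + 1 / 2 * (7 / 8)) * N ^ S := by rw [← this]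
        _ = _ := by simp only [div_eq_mul_inv]; ring
    rw [hsplit] at hint
    exact (ENNReal.add_le_add_iff_right hfin).1 hint

end MinimaxNikolskii

namespace MinimaxNikolskii

/-! ### Shifts of standard Gaussian vectors -/

/-- The density of `N(m, 1)` with respect to `N(0, 1)`. -/
noncomputable def gaussianRatio (m x : ℝ) : ℝ≥0∞ := ENNReal.ofReal (Real.exp (m * x - m ^ 2 / 2))

theorem measurable_gaussianRatio (m : ℝ) : Measurable (gaussianRatio m) := by
  unfold gaussianRatio; fun_prop

theorem gaussianReal_withDensity_ratio (m : ℝ) :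
    (gaussianReal 0 1).withDensity (gaussianRatio m) = gaussianReal m 1 := by
  rw [gaussianReal_of_var_ne_zero _ one_ne_zero, gaussianReal_of_var_ne_zero _ one_ne_zero,
    ← withDensity_mul _ (measurable_gaussianPDF _ _) (measurable_gaussianRatio m)]
  congr 1
  ext x
  simp only [Pi.mul_apply, gaussianPDF, gaussianRatio, gaussianPDFReal]
  rw [← ENNReal.ofReal_mul (by positivity), mul_assoc, ← Real.exp_add]
  congr 3
  push_cast
  ring

theorem lintegral_gaussianRatio (m : ℝ) : ∫⁻ x, gaussianRatio m x ∂gaussianReal 0 1 = 1 := by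
  have := congrArg (fun μ : Measure ℝ => μ Set.univ) (gaussianReal_withDensity_ratio m)
  simpa [withDensity_apply _ MeasurableSet.univ] using this

/-- The square of the ratio for `m` is `exp (m²)` times the ratio for `2 * m`, which has integral 1.
-/
theorem lintegral_gaussianRatio_sq (m : ℝ) :
    ∫⁻ x, gaussianRatio m x ^ 2 ∂gaussianReal 0 1 = ENNReal.ofReal (Real.exp (m ^ 2)) := by
  have : ∀ x, gaussianRatio m x ^ 2 =
      ENNReal.ofReal (Real.exp (m ^ 2)) * gaussianRatio (2 * m) x := by
    intro x
    simp only [gaussianRatio]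
    rw [← ENNReal.ofReal_pow (by positivity), ← ENNReal.ofReal_mul (by positivity), ← Real.exp_add,
      ← Real.exp_nat_mul]
    congr 2
    push_cast
    ring
  simp_rw [this]
  rw [lintegral_const_mul _ (measurable_gaussianRatio _), lintegral_gaussianRatio, mul_one]

/-- The law of the standard Gaussian vector in `ℝ^N`. -/
noncomputable abbrev stdGaussianPi (N : ℕ) : Measure (Fin N → ℝ) :=
  Measure.pi fun _ => gaussianReal 0 1

theorem map_shift_stdGaussianPi {N : ℕ} (m : ℝ) (i : Fin N) :
    (stdGaussianPi N).map (fun y k => y k + if k = i then m else 0) =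
      (stdGaussianPi N).withDensity fun y => gaussianRatio m (y i) := by
  rw [Measure.pi_map_pi (μ := fun _ : Fin N => gaussianReal 0 1)
    (f := fun k x => x + if k = i then m else 0) (fun k => by fun_prop)]
  have h1 : ∀ k, (gaussianReal 0 1).map (fun x => x + if k = i then m else 0) =
      (gaussianReal 0 1).withDensity (if k = i then gaussianRatio m else fun _ => 1) := by
    intro k
    rw [gaussianReal_map_add_const, zero_add]
    split_ifs with h
    · rw [gaussianReal_withDensity_ratio]
    · exact (withDensity_one).symm
  simp_rw [h1]
  rw [pi_withDensity]
  · congr 1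
    ext y
    rw [Finset.prod_eq_single i]
    · simp
    · intro k _ hk; simp [hk]
    · simp
  · intro k
    split_ifs
    · exact measurable_gaussianRatio m
    · exact measurable_const
  · intro k
    split_ifs
    · exact lintegral_gaussianRatio m
    · simp

theorem map_shift_pi_stdGaussianPi {S N : ℕ} (m : ℝ) (θ : Fin S → Fin N) :
    (Measure.pi fun _ : Fin S => stdGaussianPi N).map
        (fun y s k => y s k + if k = θ s then m else 0) =
      Measure.pi fun s => (stdGaussianPi N).withDensity fun y => gaussianRatio m (y (θ s)) := by
  have : ∀ s, IsProbabilityMeasure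
      ((stdGaussianPi N).map (fun y k => y k + if k = θ s then m else 0)) := fun s =>
    Measure.isProbabilityMeasure_map
      (measurable_pi_lambda _ fun k => (measurable_pi_apply k).add_const _).aemeasurable
  rw [Measure.pi_map_pi (μ := fun _ : Fin S => stdGaussianPi N)
    (f := fun s y k => y k + if k = θ s then m else 0) (fun s =>
      (measurable_pi_lambda _ fun k => (measurable_pi_apply k).add_const _).aemeasurable)]
  simp_rw [map_shift_stdGaussianPi]

/-! ### Decomposition of the white noise along an orthonormal system -/

section WhiteNoise

variable {Ω : Type*} [MeasurableSpace Ω] {P : Measure Ω} {d : ℕ}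
  {W : TestSpace d → Ω → ℝ}

theorem IsWhiteNoise.memLp (hW : IsWhiteNoise W P) (g : TestSpace d) : MemLp (W g) 2 P :=
  (hW.gaussian.hasGaussianLaw_eval g).memLp_two

theorem IsWhiteNoise.cov_eq [IsProbabilityMeasure P] (hW : IsWhiteNoise W P) (g h : TestSpace d) :
    cov[W g, W h; P] = ∫ t, g t * h t := by
  rw [covariance_eq_sub (hW.memLp g) (hW.memLp h), hW.mean, zero_mul, sub_zero]
  exact hW.covariance g h

theorem IsWhiteNoise.map_eq_gaussian [IsProbabilityMeasure P] (hW : IsWhiteNoise W P) (g : TestSpace d)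
    (hg : ∫ t, g t * g t = 1) : P.map (W g) = gaussianReal 0 1 := by
  rw [(hW.gaussian.hasGaussianLaw_eval g).map_eq_gaussianReal, hW.mean,
    ← covariance_self (hW.measurable g).aemeasurable, hW.cov_eq, hg]
  simp

variable {S N : ℕ} {e : Fin S → Fin N → TestSpace d}

theorem IsWhiteNoise.map_orthonormal [IsProbabilityMeasure P] (hW : IsWhiteNoise W P)
    (he : ∀ s k s' k', ∫ t, e s k t * e s' k' t = if s = s' ∧ k = k' then 1 else 0) :
    P.map (fun x s k => W (e s k) x) = Measure.pi fun _ : Fin S => stdGaussianPi N := by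
  have h1 : iIndepFun (fun s x k => W (e s k) x) P := by
    refine IsGaussianProcess.iIndepFun_of_covariance_eq_zero (S := fun _ : Fin S => Fin N)
      (X := fun s k => W (e s k)) (hW.gaussian.comp_right fun p : (_ : Fin S) × Fin N => e p.1 p.2)
      (fun s k => (hW.measurable _).aemeasurable) fun s s' hs k k' => ?_
    rw [hW.cov_eq, he, if_neg fun h => hs h.1]
  have h2 : ∀ s, iIndepFun (fun k x => W (e s k) x) P := by
    intro s
    have := IsGaussianProcess.iIndepFun_of_covariance_eq_zero (S := fun _ : Fin N => Unit)
      (X := fun k _ => W (e s k)) (hW.gaussian.comp_right fun p : (_ : Fin N) × Unit => e s p.1)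
      (fun k _ => (hW.measurable _).aemeasurable) fun k k' hk _ _ => by
        rw [hW.cov_eq, he, if_neg fun h => hk h.2]
    exact this.comp (fun _ (g : Unit → ℝ) => g ()) fun _ => measurable_pi_apply _
  rw [(iIndepFun_iff_map_fun_eq_pi_map fun s =>
    (measurable_pi_lambda _ fun k => hW.measurable (e s k)).aemeasurable).1 h1]
  congr 1
  ext1 s
  rw [(iIndepFun_iff_map_fun_eq_pi_map fun k => (hW.measurable (e s k)).aemeasurable).1 (h2 s)]
  congr 1
  ext1 k
  exact hW.map_eq_gaussian _ (by simp [he])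

/-- The part of the white noise that is orthogonal to the system `e`. -/
noncomputable def residual (W : TestSpace d → Ω → ℝ) (e : Fin S → Fin N → TestSpace d)
    (g : TestSpace d) (x : Ω) : ℝ :=
  W g x - ∑ s, ∑ k, (∫ t, g t * e s k t) * W (e s k) x

theorem IsWhiteNoise.measurable_residual (hW : IsWhiteNoise W P) (g : TestSpace d) :
    Measurable (residual W e g) := by
  refine (hW.measurable g).sub (Finset.measurable_fun_sum _ fun s _ =>
    Finset.measurable_fun_sum _ fun k _ => (hW.measurable _).const_mul _)

/-- The coordinates along `e` and the residual are jointly Gaussian, being linear images of `W`;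
vanishing covariances therefore give independence, and orthonormality makes the covariances vanish.
-/
theorem IsWhiteNoise.indepFun_residual [IsProbabilityMeasure P] (hW : IsWhiteNoise W P)
    (he : ∀ s k s' k', ∫ t, e s k t * e s' k' t = if s = s' ∧ k = k' then 1 else 0) :
    IndepFun (fun x (p : Fin S × Fin N) => W (e p.1 p.2) x) (fun x g => residual W e g x) P := by
  classical
  refine IsGaussianProcess.indepFun_of_covariance_eq_zero (X := fun p : Fin S × Fin N => W (e p.1 p.2))
    (Y := residual W e) ?_ (fun p => (hW.measurable _).aemeasurable)
    (fun g => (hW.measurable_residual g).aemeasurable) ?_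
  · refine hW.gaussian.of_isGaussianProcess fun i => ?_
    rcases i with p | g
    · refine ⟨{e p.1 p.2}, ContinuousLinearMap.proj ⟨_, Finset.mem_singleton_self _⟩, fun x => rfl⟩
    -- The residual at `g` is a linear functional of the values of `W` at `g` and at the finitely
    -- many `e s k`.
    · let J : Finset (TestSpace d) := insert g (Finset.univ.image fun p : Fin S × Fin N => e p.1 p.2)
      have hJ : ∀ s k, e s k ∈ J := fun s k =>
        Finset.mem_insert_of_mem (Finset.mem_image.2 ⟨(s, k), Finset.mem_univ _, rfl⟩)
      refine ⟨J, ContinuousLinearMap.proj (R := ℝ) (φ := fun _ : J => ℝ) ⟨g, Finset.mem_insert_self _ _⟩ -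
        ∑ s, ∑ k, (∫ t, g t * e s k t) •
          ContinuousLinearMap.proj (R := ℝ) (φ := fun _ : J => ℝ) ⟨e s k, hJ s k⟩, fun x => ?_⟩
      simp [residual]
  · intro p g
    have hm : ∀ s k, MemLp (fun x => (∫ t, g t * e s k t) * W (e s k) x) 2 P := fun s k =>
      (hW.memLp (e s k)).const_mul _
    have hm2 : ∀ s, MemLp (fun x => ∑ k, (∫ t, g t * e s k t) * W (e s k) x) 2 P := fun s =>
      memLp_finsetSum _ fun k _ => hm s k
    change cov[W (e p.1 p.2), fun x => W g x - ∑ s, ∑ k, (∫ t, g t * e s k t) * W (e s k) x; P] = 0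
    rw [covariance_fun_sub_right (hW.memLp _) (hW.memLp _) (memLp_finsetSum _ fun s _ => hm2 s),
      covariance_fun_sum_right hm2 (hW.memLp _)]
    simp_rw [fun s => covariance_fun_sum_right (hm s) (hW.memLp (e p.1 p.2)),
      covariance_const_mul_right, hW.cov_eq, he]
    rw [Finset.sum_eq_single p.1, Finset.sum_eq_single p.2]
    · simp [mul_comm]
    · intro k _ hk; simp [hk.symm]
    · simp
    · intro s _ hs
      simp [hs.symm]
    · simp

/-- The observation rebuilt from its coordinates along `e` and the residual noise. -/
noncomputable def rebuild (e : Fin S → Fin N → TestSpace d) (ε : ℝ)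
    (z : (Fin S → Fin N → ℝ) × Obs d) : Obs d :=
  fun g => ε * ((∑ s, ∑ k, (∫ t, g t * e s k t) * z.1 s k) + z.2 g)

theorem measurable_rebuild (ε : ℝ) : Measurable (rebuild e ε) := by
  refine measurable_pi_lambda _ fun g => ?_
  unfold rebuild
  refine Measurable.const_mul (Measurable.add (Finset.measurable_fun_sum _ fun s _ =>
    Finset.measurable_fun_sum _ fun k _ => Measurable.const_mul ?_ _) ?_) _
  · exact (measurable_pi_apply k).comp ((measurable_pi_apply s).comp measurable_fst)
  · exact (measurable_pi_apply g).comp measurable_snd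

/-- By `hf` the signal `f θ` lies in the span of `e`, so it only shifts coordinate `θ s` of each
block by `m`, in units of `ε`. With the residual frozen, this is the finite-dimensional problem of
`bayes_lower_bound`; integrating over the residual bounds the average over the words, and some word
is at least average. -/
theorem IsWhiteNoise.exists_lintegral_ge [IsProbabilityMeasure P] (hW : IsWhiteNoise W P) (hS : 0 < S) (hN : 0 < N)
    (he : ∀ s k s' k', ∫ t, e s k t * e s' k' t = if s = s' ∧ k = k' then 1 else 0)
    {m ε : ℝ} (hm : Real.exp (m ^ 2) ≤ 3 / 4 * N) (f : (Fin S → Fin N) → (Fin d → ℝ) → ℝ)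
    (hf : ∀ θ (g : TestSpace d), ∫ t, f θ t * g t = ε * ∑ s, m * ∫ t, g t * e s (θ s) t)
    (F : (Fin S → Fin N) → Obs d → ℝ≥0∞) (hF : ∀ θ, Measurable (F θ)) (a : ℝ≥0∞) (ha : a ≠ ∞)
    (haF : ∀ θ θ' X, a * (hamming θ θ' / S) ≤ F θ X + F θ' X) :
    ∃ θ, a / 16 ≤ ∫⁻ x, F θ (observation W ε (f θ) x) ∂P := by
  let ξ : Ω → Fin S → Fin N → ℝ := fun x s k => W (e s k) x
  let R : Ω → Obs d := fun x g => residual W e g x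
  let sh : (Fin S → Fin N) → (Fin S → Fin N → ℝ) → Fin S → Fin N → ℝ :=
    fun θ y s k => y s k + if k = θ s then m else 0
  have hξ : Measurable ξ :=
    measurable_pi_lambda _ fun s => measurable_pi_lambda _ fun k => hW.measurable _
  have hR : Measurable R := measurable_pi_lambda _ fun g => hW.measurable_residual g
  have hsh : ∀ θ, Measurable (sh θ) := fun θ => by fun_prop
  have hobs : ∀ θ x, observation W ε (f θ) x = rebuild e ε (sh θ (ξ x), R x) := by
    intro θ x
    ext g
    simp only [observation, rebuild, sh, ξ, R, residual, hf, mul_add, Finset.sum_add_distrib]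
    simp only [mul_ite, mul_zero, Finset.sum_ite_eq', Finset.mem_univ, if_true]
    simp_rw [mul_comm m]
    ring
  have hjoint : P.map (fun x => (ξ x, R x)) =
      (Measure.pi fun _ : Fin S => stdGaussianPi N).prod (P.map R) := by
    have hind : IndepFun ξ R P :=
      (hW.indepFun_residual he).comp (φ := fun y (s : Fin S) (k : Fin N) => y (s, k))
        (measurable_pi_lambda _ fun s => measurable_pi_lambda _ fun k => measurable_pi_apply _)
        measurable_id
    rw [(indepFun_iff_map_prod_eq_prod_map_map hξ.aemeasurable hR.aemeasurable).1 hind,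
      hW.map_orthonormal he]
  have : IsProbabilityMeasure (P.map R) := Measure.isProbabilityMeasure_map hR.aemeasurable
  have hmeas : ∀ θ, Measurable fun z : (Fin S → Fin N → ℝ) × Obs d => F θ (rebuild e ε z) :=
    fun θ => (hF θ).comp (measurable_rebuild ε)
  have hint : ∀ θ, ∫⁻ x, F θ (observation W ε (f θ) x) ∂P =
      ∫⁻ ρ, ∫⁻ y, F θ (rebuild e ε (y, ρ)) ∂(Measure.pi fun s =>
        (stdGaussianPi N).withDensity fun y => gaussianRatio m (y (θ s))) ∂P.map R := by
    intro θ
    have h1 : Measurable fun z : (Fin S → Fin N → ℝ) × Obs d =>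
        F θ (rebuild e ε (sh θ z.1, z.2)) :=
      (hmeas θ).comp (((hsh θ).comp measurable_fst).prodMk measurable_snd)
    simp_rw [hobs]
    rw [← lintegral_map (f := fun z : (Fin S → Fin N → ℝ) × Obs d =>
      F θ (rebuild e ε (sh θ z.1, z.2))) h1 (hξ.prodMk hR), hjoint, lintegral_prod_symm' _ h1]
    refine lintegral_congr fun ρ => ?_
    rw [← map_shift_pi_stdGaussianPi m θ]
    exact (lintegral_map (f := fun y => F θ (rebuild e ε (y, ρ)))
      ((hmeas θ).comp measurable_prodMk_right) (hsh θ)).symm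
  have hl : ∀ i : Fin N, Measurable fun y : Fin N → ℝ => gaussianRatio m (y i) := fun i =>
    (measurable_gaussianRatio m).comp (measurable_pi_apply i)
  have hbayes : ∀ ρ, a / 16 * N ^ S ≤ ∑ θ, ∫⁻ y, F θ (rebuild e ε (y, ρ)) ∂(Measure.pi fun s =>
        (stdGaussianPi N).withDensity fun y => gaussianRatio m (y (θ s))) := by
    intro ρ
    refine bayes_lower_bound (stdGaussianPi N) hS hN (fun i y => gaussianRatio m (y i)) hl ?_ ?_
      (fun θ y => F θ (rebuild e ε (y, ρ))) (fun θ => (hmeas θ).comp measurable_prodMk_right) a ha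
      (fun θ θ' y => haF θ θ' _)
    · intro i
      rw [(measurePreserving_eval (fun _ : Fin N => gaussianReal 0 1) i).lintegral_comp
        (measurable_gaussianRatio m), lintegral_gaussianRatio]
    · intro i
      rw [(measurePreserving_eval (fun _ : Fin N => gaussianReal 0 1) i).lintegral_comp
        ((measurable_gaussianRatio m).pow_const 2), lintegral_gaussianRatio_sq]
      refine (ENNReal.ofReal_le_ofReal hm).trans (le_of_eq ?_)
      rw [ENNReal.ofReal_mul (by norm_num), ENNReal.ofReal_div_of_pos (by norm_num)]
      simp
  by_contra! hcon
  have hsum : ∑ θ, ∫⁻ x, F θ (observation W ε (f θ) x) ∂P < a / 16 * N ^ S := by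
    have : Nonempty (Fin S → Fin N) := ⟨fun _ => ⟨0, hN⟩⟩
    refine (ENNReal.sum_lt_sum_of_nonempty Finset.univ_nonempty fun θ _ => hcon θ).trans_le ?_
    simp [mul_comm]
  refine absurd hsum (not_lt.2 ?_)
  have hmm : ∀ θ, Measurable fun ρ => ∫⁻ y, F θ (rebuild e ε (y, ρ)) ∂(Measure.pi fun s =>
        (stdGaussianPi N).withDensity fun y => gaussianRatio m (y (θ s))) := by
    intro θ
    have : IsProbabilityMeasure (Measure.pi fun s =>
        (stdGaussianPi N).withDensity fun y => gaussianRatio m (y (θ s))) := by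
      rw [← map_shift_pi_stdGaussianPi m θ]
      exact Measure.isProbabilityMeasure_map (hsh θ).aemeasurable
    exact (hmeas θ).lintegral_prod_left'
  simp_rw [hint]
  rw [← lintegral_finsetSum _ fun θ _ => hmm θ]
  calc a / 16 * N ^ S = ∫⁻ _ρ, a / 16 * N ^ S ∂P.map R := by simp
    _ ≤ _ := lintegral_mono hbayes

end WhiteNoise

end MinimaxNikolskii

namespace MinimaxNikolskii

/-! ### Finite differences of smooth functions on the line -/

theorem hasDerivAt_fwdDiff_iter {g g' : ℝ → ℝ} (hg : ∀ y, HasDerivAt g (g' y) y) (v : ℝ) (k : ℕ)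
    (y : ℝ) : HasDerivAt ((fwdDiff v)^[k] g) ((fwdDiff v)^[k] g' y) y := by
  induction k generalizing g g' with
  | zero => exact hg y
  | succ k ih =>
    simp only [Function.iterate_succ_apply]
    exact ih fun z => ((hg (z + v)).comp_add_const z v).sub (hg z)

/-- Differences commute with the derivative, so each further difference costs a factor `|v|` by the
mean value inequality applied with the bound for `deriv g`. -/
theorem abs_fwdDiff_iter_le_pow (k : ℕ) {g : ℝ → ℝ} (hg : ContDiff ℝ ((⊤ : ℕ∞) : WithTop ℕ∞) g)
    (hc : HasCompactSupport g) : ∃ C, ∀ v y, |(fwdDiff v)^[k] g y| ≤ C * |v| ^ k := by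
  induction k generalizing g with
  | zero =>
    obtain ⟨C, hC⟩ := hc.exists_bound_of_continuous hg.continuous
    exact ⟨C, fun v y => by simpa using hC y⟩
  | succ k ih =>
    obtain ⟨C, hC⟩ := ih (g := deriv g) (contDiff_infty_iff_deriv.1 hg).2 hc.deriv
    refine ⟨C, fun v y => ?_⟩
    have hd : ∀ z, HasDerivAt g (deriv g z) z := fun z =>
      ((contDiff_infty_iff_deriv.1 hg).1 z).hasDerivAt
    have := convex_univ.norm_image_sub_le_of_norm_hasDerivWithin_le
      (f := (fwdDiff v)^[k] g) (C := C * |v| ^ k) (x := y) (y := y + v)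
      (fun z _ => (hasDerivAt_fwdDiff_iter hd v k z).hasDerivWithinAt)
      (fun z _ => hC v z) trivial trivial
    rw [Function.iterate_succ_apply', pow_succ, ← mul_assoc]
    simpa [fwdDiff] using this

theorem abs_fwdDiff_iter_le {M : Type*} [AddCommMonoid M] {g : M → ℝ} {B : ℝ}
    (hg : ∀ y, |g y| ≤ B) (v : M) (k : ℕ) (y : M) : |(fwdDiff v)^[k] g y| ≤ 2 ^ k * B := by
  induction k generalizing y with
  | zero => simpa using hg y
  | succ k ih =>
    rw [Function.iterate_succ_apply']
    have := abs_sub ((fwdDiff v)^[k] g (y + v)) ((fwdDiff v)^[k] g y)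
    have h1 := ih (y + v)
    have h2 := ih y
    simp only [fwdDiff] at *
    rw [pow_succ]
    linarith

theorem exists_shift_ne_zero {M : Type*} [AddCommMonoid M] {g : M → ℝ} {v : M} {k : ℕ} {y : M}
    (h : (fwdDiff v)^[k] g y ≠ 0) : ∃ i ∈ Finset.range (k + 1), g (y + i • v) ≠ 0 := by
  rw [fwdDiff_iter_eq_sum_shift] at h
  obtain ⟨i, hi, hne⟩ := Finset.exists_ne_zero_of_sum_ne_zero h
  exact ⟨i, hi, fun h0 => hne (by rw [h0, smul_zero])⟩

/-! ### Bumps -/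

/-- A smooth bump on the line, supported in `(-1/2, 1/2)` and equal to `1` on `[-1/4, 1/4]`. -/
noncomputable def bumpLine : ContDiffBump (0 : ℝ) := ⟨1 / 4, 1 / 2, by norm_num, by norm_num⟩

/-- For `|v| ≤ 1` the bound of order `|v| ^ k` is stronger since `β < k`; for `|v| ≥ 1` the trivial
bound `2 ^ k` suffices. -/
theorem abs_fwdDiff_bumpLine_le {β : ℝ} {k : ℕ} (hβ : 0 < β) (hk : β < k) :
    ∃ C : ℝ, 1 ≤ C ∧ ∀ v y, |(fwdDiff v)^[k] (bumpLine : ℝ → ℝ) y| ≤ C * |v| ^ β := by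
  obtain ⟨C, hC⟩ := abs_fwdDiff_iter_le_pow k (g := (bumpLine : ℝ → ℝ)) bumpLine.contDiff
    bumpLine.hasCompactSupport
  refine ⟨max C (2 ^ k), le_max_of_le_right (one_le_pow₀ (by norm_num)), fun v y => ?_⟩
  rcases le_total |v| 1 with hv | hv
  · have h0 : (0 : ℝ) ≤ max C (2 ^ k) := le_max_of_le_right (by positivity)
    calc _ ≤ C * |v| ^ k := hC v y
      _ ≤ max C (2 ^ k) * |v| ^ k := by gcongr; exact le_max_left _ _
      _ ≤ max C (2 ^ k) * |v| ^ β := by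
        gcongr
        rw [← Real.rpow_natCast]
        rcases (abs_nonneg v).eq_or_lt with h | h
        · rw [← h, Real.zero_rpow hβ.ne', Real.zero_rpow (hβ.trans hk).ne']
        · exact Real.rpow_le_rpow_of_exponent_ge h hv hk.le
  · have h1 := abs_fwdDiff_iter_le (g := (bumpLine : ℝ → ℝ)) (B := 1)
      (fun y => by rw [abs_of_nonneg bumpLine.nonneg]; exact bumpLine.le_one) v k y
    have h2 : 1 ≤ |v| ^ β := Real.one_le_rpow hv hβ.le
    calc _ ≤ 2 ^ k * 1 := h1
      _ ≤ max C (2 ^ k) * |v| ^ β := by gcongr; exact le_max_right _ _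

variable {d : ℕ}

/-- The tensor product bump with centre `t` and side lengths `h`. -/
noncomputable def bump (h t x : Fin d → ℝ) : ℝ := ∏ j, bumpLine ((x j - t j) / h j)

/-- The open box with centre `t` and side lengths `h`. -/
def box (h t : Fin d → ℝ) : Set (Fin d → ℝ) :=
  Set.univ.pi fun j => Set.Ioo (t j - h j / 2) (t j + h j / 2)

theorem mem_box {h t x : Fin d → ℝ} : x ∈ box h t ↔ ∀ j, |x j - t j| < h j / 2 := by
  simp only [box, Set.mem_univ_pi, Set.mem_Ioo, abs_lt]
  exact forall_congr' fun j => ⟨fun h => ⟨by linarith, by linarith⟩, fun h => ⟨by linarith, by linarith⟩⟩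

theorem measurableSet_box (h t : Fin d → ℝ) : MeasurableSet (box h t) :=
  MeasurableSet.univ_pi fun _ => measurableSet_Ioo

theorem volume_box {h : Fin d → ℝ} (hh : ∀ j, 0 < h j) (t : Fin d → ℝ) :
    volume (box h t) = ENNReal.ofReal (∏ j, h j) := by
  rw [box, volume_pi_pi, ENNReal.ofReal_prod_of_nonneg fun j _ => (hh j).le]
  refine Finset.prod_congr rfl fun j _ => ?_
  rw [Real.volume_Ioo]
  congr 1; ring

theorem continuous_bump (h t : Fin d → ℝ) : Continuous (bump h t) :=
  continuous_finsetProd _ fun j _ => bumpLine.continuous.comp (by fun_prop)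

theorem bump_nonneg (h t x : Fin d → ℝ) : 0 ≤ bump h t x :=
  Finset.prod_nonneg fun _ _ => bumpLine.nonneg

theorem bump_le_one (h t x : Fin d → ℝ) : bump h t x ≤ 1 :=
  Finset.prod_le_one (fun _ _ => bumpLine.nonneg) fun _ _ => bumpLine.le_one

theorem mem_box_of_bump_ne_zero {h t x : Fin d → ℝ} (hh : ∀ j, 0 < h j) (hx : bump h t x ≠ 0) :
    x ∈ box h t := by
  rw [mem_box]
  intro j
  have := Finset.prod_ne_zero_iff.1 hx j (Finset.mem_univ j)
  have hs : (x j - t j) / h j ∈ Function.support (bumpLine : ℝ → ℝ) := this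
  rw [bumpLine.support_eq, mem_ball_zero_iff, Real.norm_eq_abs, abs_div, abs_of_pos (hh j),
    div_lt_iff₀ (hh j)] at hs
  change _ < (1 / 2 : ℝ) * _ at hs
  linarith

theorem bump_eq_one {h t x : Fin d → ℝ} (hh : ∀ j, 0 < h j)
    (hx : x ∈ box (fun j => h j / 2) t) : bump h t x = 1 := by
  rw [mem_box] at hx
  refine Finset.prod_eq_one fun j _ => bumpLine.one_of_mem_closedBall ?_
  rw [mem_closedBall_zero_iff, Real.norm_eq_abs, abs_div, abs_of_pos (hh j), div_le_iff₀ (hh j)]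
  change _ ≤ (1 / 4 : ℝ) * _
  linarith [hx j]

theorem box_half_subset {h t : Fin d → ℝ} (hh : ∀ j, 0 < h j) :
    box (fun j => h j / 2) t ⊆ box h t := by
  intro x hx
  rw [mem_box] at *
  intro j
  linarith [hx j, hh j]

theorem center_mem_box {h t : Fin d → ℝ} (hh : ∀ j, 0 < h j) : t ∈ box h t := by
  rw [mem_box]; intro j; simpa using hh j

theorem bump_eq_bump_zero (h t x : Fin d → ℝ) : bump h t x = bump h 0 (x - t) := by
  simp [bump]

theorem fwdDiff_iter_mul_comp (j : Fin d) (u η τ : ℝ) (hη : η ≠ 0) (c : (Fin d → ℝ) → ℝ)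
    (hc : ∀ x, c (x + Pi.single j u) = c x) (φ : ℝ → ℝ) (k : ℕ) :
    (fwdDiff (Pi.single j u))^[k] (fun x : Fin d → ℝ => c x * φ ((x j - τ) / η)) =
      fun x => c x * (fwdDiff (u / η))^[k] φ ((x j - τ) / η) := by
  induction k generalizing φ with
  | zero => rfl
  | succ k ih =>
    rw [Function.iterate_succ_apply, Function.iterate_succ_apply, ← ih]
    congr 1
    ext x
    simp only [fwdDiff, hc, Pi.add_apply, Pi.single_eq_same, mul_sub]
    congr 3
    field_simp
    ring

theorem abs_diffOp_bump_le {h : Fin d → ℝ} (hh : ∀ j, 0 < h j) (t : Fin d → ℝ) {β C : ℝ} {k : ℕ}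
    (hC : ∀ v y, |(fwdDiff v)^[k] (bumpLine : ℝ → ℝ) y| ≤ C * |v| ^ β) (u : ℝ) (j : Fin d)
    (x : Fin d → ℝ) : |diffOp k u j (bump h t) x| ≤ C * (|u| ^ β / h j ^ β) := by
  let c : (Fin d → ℝ) → ℝ := fun x => ∏ i ∈ Finset.univ.erase j, bumpLine ((x i - t i) / h i)
  have hb : bump h t = fun x => c x * bumpLine ((x j - t j) / h j) := by
    ext x
    exact (Finset.prod_erase_mul _ _ (Finset.mem_univ j)).symm
  have hc : ∀ x, c (x + Pi.single j u) = c x := by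
    intro x
    refine Finset.prod_congr rfl fun i hi => ?_
    simp [Finset.ne_of_mem_erase hi]
  have hc0 : ∀ x, 0 ≤ c x := fun x => Finset.prod_nonneg fun _ _ => bumpLine.nonneg
  have hc1 : ∀ x, c x ≤ 1 := fun x =>
    Finset.prod_le_one (fun _ _ => bumpLine.nonneg) fun _ _ => bumpLine.le_one
  rw [diffOp, hb, fwdDiff_iter_mul_comp j u (h j) (t j) (hh j).ne' c hc]
  simp only [abs_mul, abs_of_nonneg (hc0 x)]
  calc _ ≤ 1 * (C * |u / h j| ^ β) := by
        gcongr
        · exact hc1 x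
        · exact hC _ _
    _ = _ := by
        rw [one_mul, abs_div, abs_of_pos (hh j), Real.div_rpow (abs_nonneg _) (hh j).le]

/-! ### Norms of functions supported in a set of small measure -/

theorem normLp_univ_le {r : ℝ≥0∞} (hr : 1 ≤ r) {g : (Fin d → ℝ) → ℝ} {B v : ℝ} (hB : 0 ≤ B)
    (hv : 0 ≤ v) (hgB : ∀ x, |g x| ≤ B) {E : Set (Fin d → ℝ)} (hE : MeasurableSet E)
    (hgE : ∀ x, g x ≠ 0 → x ∈ E) (hEv : volume E ≤ ENNReal.ofReal v) :
    normLp r Set.univ g ≤ ENNReal.ofReal (B * v ^ (r⁻¹).toReal) := by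
  unfold normLp
  split_ifs with h
  · subst h
    simp only [ENNReal.inv_top, ENNReal.toReal_zero, Real.rpow_zero, mul_one]
    exact iSup₂_le fun x _ => ENNReal.ofReal_le_ofReal (hgB x)
  · have hr0 : r ≠ 0 := (zero_lt_one.trans_le hr).ne'
    rw [Measure.restrict_univ]
    calc eLpNorm g r volume ≤ eLpNorm (E.indicator fun _ => B) r volume := by
          refine eLpNorm_mono fun x => ?_
          by_cases hx : x ∈ E
          · rw [Set.indicator_of_mem hx]
            simpa [abs_of_nonneg hB] using hgB x
          · have : g x = 0 := by by_contra h0; exact hx (hgE x h0)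
            simp [this]
      _ = ‖B‖ₑ * volume E ^ (1 / r.toReal) := eLpNorm_indicator_const hE hr0 h
      _ ≤ ENNReal.ofReal B * ENNReal.ofReal v ^ (1 / r.toReal) := by
          gcongr
          rw [Real.enorm_eq_ofReal hB]
      _ = _ := by
          rw [ENNReal.ofReal_mul hB, ENNReal.toReal_inv, one_div,
            ENNReal.ofReal_rpow_of_nonneg hv (by positivity)]

/-! ### Sums of bumps over disjoint cells -/

/-- The centre of the cell with index `m` in the grid of mesh `h` of the cube `(-b, b)^d`. -/
noncomputable def cellCenter (b : ℝ) (h : Fin d → ℝ) (m : Fin d → ℕ) : Fin d → ℝ :=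
  fun j => -b + (m j + 1 / 2) * h j

theorem eq_of_mem_box {b : ℝ} {h : Fin d → ℝ} (hh : ∀ j, 0 < h j) {m m' : Fin d → ℕ}
    {x : Fin d → ℝ} (hx : x ∈ box h (cellCenter b h m)) (hx' : x ∈ box h (cellCenter b h m')) :
    m = m' := by
  rw [mem_box] at hx hx'
  ext j
  have h1 := abs_lt.1 (hx j)
  have h2 := abs_lt.1 (hx' j)
  simp only [cellCenter] at h1 h2
  have h3 : (m j : ℝ) * h j < (m' j + 1) * h j := by nlinarith
  have h4 : (m' j : ℝ) * h j < (m j + 1) * h j := by nlinarith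
  have h5 := lt_of_mul_lt_mul_right h3 (hh j).le
  have h6 := lt_of_mul_lt_mul_right h4 (hh j).le
  norm_cast at h5 h6
  omega

theorem box_subset_cube {b : ℝ} {h : Fin d → ℝ} (hh : ∀ j, 0 < h j) {m : Fin d → ℕ}
    (hm : ∀ j, (m j + 1) * h j ≤ 2 * b) : box h (cellCenter b h m) ⊆ cube d b := by
  intro x hx j
  rw [mem_box] at hx
  have h1 := abs_lt.1 (hx j)
  simp only [cellCenter] at h1
  have := hm j
  have : 0 ≤ (m j : ℝ) * h j := mul_nonneg (Nat.cast_nonneg _) (hh j).le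
  constructor <;> nlinarith

/-- `A` times the sum of the bumps over the cells with indices `c s`. -/
noncomputable def bumpSum (b : ℝ) (h : Fin d → ℝ) (A : ℝ) {S : ℕ} (c : Fin S → Fin d → ℕ) :
    (Fin d → ℝ) → ℝ :=
  A • ∑ s, bump h (cellCenter b h (c s))

theorem bumpSum_apply (b : ℝ) (h : Fin d → ℝ) (A : ℝ) {S : ℕ} (c : Fin S → Fin d → ℕ)
    (x : Fin d → ℝ) : bumpSum b h A c x = A * ∑ s, bump h (cellCenter b h (c s)) x := by
  simp [bumpSum]

theorem continuous_bumpSum (b : ℝ) (h : Fin d → ℝ) (A : ℝ) {S : ℕ} (c : Fin S → Fin d → ℕ) :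
    Continuous (bumpSum b h A c) := by
  have : bumpSum b h A c = fun x => A * ∑ s, bump h (cellCenter b h (c s)) x :=
    funext (bumpSum_apply b h A c)
  rw [this]
  exact continuous_const.mul (continuous_finsetSum _ fun s _ => continuous_bump _ _)

section Signal

variable {b : ℝ} {h : Fin d → ℝ} {A : ℝ} {S : ℕ} {c : Fin S → Fin d → ℕ}

/-- The difference at `x` sees only the `k + 1` points `x + i u e_j`, each in at most one cell. So
at most `k + 1` bumps contribute, however large `S` is. -/
theorem abs_diffOp_bumpSum_le (hh : ∀ j, 0 < h j) (hA : 0 ≤ A) (hc : Function.Injective c) (k : ℕ)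
    (u : ℝ) (j : Fin d) {B : ℝ} (hB : ∀ t x, |diffOp k u j (bump h t) x| ≤ B) (x : Fin d → ℝ) :
    |diffOp k u j (bumpSum b h A c) x| ≤ A * ((k + 1) * B) := by
  have hB0 : 0 ≤ B := (abs_nonneg _).trans (hB 0 0)
  have h1 : diffOp k u j (bumpSum b h A c) x =
      A * ∑ s, diffOp k u j (bump h (cellCenter b h (c s))) x := by
    simp only [diffOp, bumpSum]
    rw [fwdDiff_iter_const_smul, fwdDiff_iter_finsetSum]
    simp
  rw [h1, abs_mul, abs_of_nonneg hA]
  gcongr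
  set a : Fin S → ℝ := fun s => diffOp k u j (bump h (cellCenter b h (c s))) x
  have hcard : (Finset.univ.filter fun s => a s ≠ 0).card ≤ k + 1 := by
    classical
    have hsub : (Finset.univ.filter fun s => a s ≠ 0) ⊆ (Finset.range (k + 1)).biUnion fun i =>
        Finset.univ.filter fun s => x + i • Pi.single j u ∈ box h (cellCenter b h (c s)) := by
      intro s hs
      obtain ⟨i, hi, hne⟩ := exists_shift_ne_zero (Finset.mem_filter.1 hs).2
      exact Finset.mem_biUnion.2 ⟨i, hi, Finset.mem_filter.2
        ⟨Finset.mem_univ _, mem_box_of_bump_ne_zero hh hne⟩⟩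
    refine (Finset.card_le_card hsub).trans (Finset.card_biUnion_le.trans ?_)
    refine (Finset.sum_le_sum (g := fun _ => 1) fun i _ => ?_).trans (by simp)
    refine Finset.card_le_one.2 fun s hs s' hs' => hc ?_
    exact eq_of_mem_box hh (Finset.mem_filter.1 hs).2 (Finset.mem_filter.1 hs').2
  calc |∑ s, a s| ≤ ∑ s, |a s| := Finset.abs_sum_le_sum_abs _ _
    _ = ∑ s ∈ Finset.univ.filter fun s => a s ≠ 0, |a s| := by
        refine (Finset.sum_subset (Finset.subset_univ _) fun s _ hs => ?_).symm
        simpa using hs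
    _ ≤ (Finset.univ.filter fun s => a s ≠ 0).card • B :=
        Finset.sum_le_card_nsmul _ _ _ fun s _ => hB _ _
    _ ≤ (k + 1) * B := by
        rw [nsmul_eq_mul]
        gcongr
        exact_mod_cast hcard

theorem normLp_diffOp_bumpSum_le (hh : ∀ j, 0 < h j) (hA : 0 ≤ A) (hc : Function.Injective c)
    {r : ℝ≥0∞} (hr : 1 ≤ r) (k : ℕ) (u : ℝ) (j : Fin d) {B : ℝ}
    (hB : ∀ t x, |diffOp k u j (bump h t) x| ≤ B) :
    normLp r Set.univ (diffOp k u j (bumpSum b h A c)) ≤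
      ENNReal.ofReal (A * ((k + 1) * B) * ((k + 1) * (S * ∏ j, h j)) ^ (r⁻¹).toReal) := by
  have hB0 : 0 ≤ B := (abs_nonneg _).trans (hB 0 0)
  have hV : 0 ≤ ∏ j, h j := Finset.prod_nonneg fun j _ => (hh j).le
  refine normLp_univ_le hr (by positivity) (by positivity)
    (abs_diffOp_bumpSum_le hh hA hc k u j hB)
    (E := ⋃ i ∈ Finset.range (k + 1), ⋃ s,
      (fun x : Fin d → ℝ => x + i • Pi.single j u) ⁻¹' box h (cellCenter b h (c s))) ?_ ?_ ?_
  · exact Finset.measurableSet_biUnion _ fun i _ => MeasurableSet.iUnion fun s =>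
      (measurableSet_box _ _).preimage (by fun_prop)
  · intro x hx
    obtain ⟨i, hi, hne⟩ := exists_shift_ne_zero hx
    rw [bumpSum_apply] at hne
    obtain ⟨s, -, hs⟩ := Finset.exists_ne_zero_of_sum_ne_zero (right_ne_zero_of_mul hne)
    simp only [Set.mem_iUnion]
    exact ⟨i, hi, s, mem_box_of_bump_ne_zero hh hs⟩
  · refine (measure_biUnion_finset_le _ _).trans ?_
    have : ∀ i ∈ Finset.range (k + 1), volume (⋃ s : Fin S,
        (fun x : Fin d → ℝ => x + i • Pi.single j u) ⁻¹' box h (cellCenter b h (c s))) ≤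
        ENNReal.ofReal (S * ∏ j, h j) := by
      intro i _
      refine (measure_iUnion_fintype_le _ _).trans ?_
      simp_rw [measure_preimage_add_right, volume_box hh]
      rw [ENNReal.ofReal_mul (by positivity)]
      simp
    refine (Finset.sum_le_sum this).trans (le_of_eq ?_)
    rw [ENNReal.ofReal_mul (by positivity) (p := (k : ℝ) + 1)]
    have e : ENNReal.ofReal ((k : ℝ) + 1) = (k : ℝ≥0∞) + 1 := by
      rw [ENNReal.ofReal_add (by positivity) (by norm_num)]; simp
    simp [e]

/-- In `hL`, one factor `k j + 1` counts the overlapping bumps and the other bounds the `1 / r j`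
power of the `k j + 1` translates of the support; `h j ^ β j` comes from rescaling the step. The
bound on the norm itself follows from the same condition because `h j ≤ 1`. -/
theorem bumpSum_mem_signals (hd : 0 < d) (hh : ∀ j, 0 < h j) (hh1 : ∀ j, h j ≤ 1) (hA : 0 ≤ A)
    (hc : Function.Injective c) (hcb : ∀ s j, (c s j + 1) * h j ≤ 2 * b) {p : ℝ≥0∞} (hp : 1 ≤ p)
    {r : Fin d → ℝ≥0∞} (hr : ∀ j, 1 ≤ r j) {β L : Fin d → ℝ} (hβ : ∀ j, 0 < β j)
    {k : Fin d → ℕ} (hk : ∀ j, β j < k j) {C : Fin d → ℝ} (hC1 : ∀ j, 1 ≤ C j)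
    (hC : ∀ j v y, |(fwdDiff v)^[k j] (bumpLine : ℝ → ℝ) y| ≤ C j * |v| ^ β j)
    (hL : ∀ j, (k j + 1) ^ 2 * C j * (A * (S * ∏ i, h i) ^ ((r j)⁻¹).toReal) ≤ L j * h j ^ β j) :
    bumpSum b h A c ∈ signals b p r β L := by
  have hV : 0 ≤ ∏ j, h j := Finset.prod_nonneg fun j _ => (hh j).le
  have hmeas : Measurable (bumpSum b h A c) := (continuous_bumpSum b h A c).measurable
  have hnorm : ∀ {s : ℝ≥0∞}, 1 ≤ s → ∀ j : Fin d, normLp s Set.univ (bumpSum b h A c) ≤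
      ENNReal.ofReal (A * (S * ∏ j, h j) ^ (s⁻¹).toReal) := by
    intro s hs j
    -- The difference of order 0 is the function itself.
    have := normLp_diffOp_bumpSum_le (b := b) hh hA hc hs 0 0 j (B := 1) fun t x => by
      simpa [diffOp, abs_of_nonneg (bump_nonneg _ _ _)] using bump_le_one h t x
    simpa [diffOp] using this
  have hnorm' : ∀ {s : ℝ≥0∞}, 1 ≤ s → normLp s Set.univ (bumpSum b h A c) < ∞ := by
    exact fun hs => (hnorm hs ⟨0, hd⟩).trans_lt ENNReal.ofReal_lt_top
  have hL0 : ∀ j, 0 ≤ L j := by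
    intro j
    have h1 : 0 ≤ (k j + 1) ^ 2 * C j * (A * (S * ∏ i, h i) ^ ((r j)⁻¹).toReal) := by
      have := zero_le_one.trans (hC1 j)
      positivity
    exact nonneg_of_mul_nonneg_left (h1.trans (hL j)) (Real.rpow_pos_of_pos (hh j) _)
  refine ⟨⟨⟨hmeas, fun j => (hnorm (hr j) j).trans (ENNReal.ofReal_le_ofReal ?_), fun j =>
    ⟨k j, hk j, fun u => ?_⟩⟩, hmeas, hnorm' (by norm_num)⟩, ⟨hmeas, hnorm' hp⟩, fun x hx => ?_⟩
  · have h0 : 0 ≤ A * (S * ∏ i, h i) ^ ((r j)⁻¹).toReal := by positivity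
    have h1 : (1 : ℝ) ≤ (k j + 1) ^ 2 * C j :=
      one_le_mul_of_one_le_of_one_le (one_le_pow₀ (by simp)) (hC1 j)
    have h2 : h j ^ β j ≤ 1 := Real.rpow_le_one (hh j).le (hh1 j) (hβ j).le
    have h3 : 0 < h j ^ β j := Real.rpow_pos_of_pos (hh j) _
    have h4 := hL j
    have hLj := hL0 j
    nlinarith [mul_le_mul_of_nonneg_right h1 h0, mul_le_mul_of_nonneg_left h2 hLj]
  · refine (normLp_diffOp_bumpSum_le hh hA hc (hr j) (k j) u j
      fun t x => abs_diffOp_bump_le hh t (hC j) u j x).trans (ENNReal.ofReal_le_ofReal ?_)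
    have hr1 : ((r j)⁻¹).toReal ≤ 1 := by
      have := ENNReal.toReal_mono ENNReal.one_ne_top (ENNReal.inv_le_one.2 (hr j))
      simpa using this
    have h1 : ((k j : ℝ) + 1) ^ ((r j)⁻¹).toReal ≤ k j + 1 := by
      calc ((k j : ℝ) + 1) ^ ((r j)⁻¹).toReal ≤ ((k j : ℝ) + 1) ^ (1 : ℝ) :=
            Real.rpow_le_rpow_of_exponent_le (by simp) hr1
        _ = _ := Real.rpow_one _
    have h3 : 0 < h j ^ β j := Real.rpow_pos_of_pos (hh j) _
    have hC0 : 0 ≤ C j := zero_le_one.trans (hC1 j)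
    rw [Real.mul_rpow (by positivity) (by positivity)]
    calc _ ≤ A * ((k j + 1) * (C j * (|u| ^ β j / h j ^ β j))) *
          ((k j + 1) * (S * ∏ j, h j) ^ ((r j)⁻¹).toReal) := by gcongr
      _ = (k j + 1) ^ 2 * C j * (A * (S * ∏ i, h i) ^ ((r j)⁻¹).toReal) *
          (|u| ^ β j / h j ^ β j) := by ring
      _ ≤ L j * h j ^ β j * (|u| ^ β j / h j ^ β j) :=
          mul_le_mul_of_nonneg_right (hL j) (by positivity)
      _ = L j * |u| ^ β j := by field_simp
  · rw [bumpSum_apply, Finset.sum_eq_zero, mul_zero]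
    intro s _
    by_contra hne
    exact hx (box_subset_cube hh (hcb s) (mem_box_of_bump_ne_zero hh hne))

end Signal

end MinimaxNikolskii

namespace MinimaxNikolskii

variable {d : ℕ} {b : ℝ} {h : Fin d → ℝ} {A : ℝ} {S N : ℕ} {pos : Fin S → Fin N → Fin d → ℕ}

theorem toReal_inv_le_one {p : ℝ≥0∞} (hp : 1 ≤ p) : (p⁻¹).toReal ≤ 1 := by
  simpa using ENNReal.toReal_mono ENNReal.one_ne_top (ENNReal.inv_le_one.2 hp)

/-! ### The hypotheses indexed by words -/

theorem bumpSum_on_box (hh : ∀ j, 0 < h j)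
    (hpos : ∀ s k s' k', pos s k = pos s' k' → s = s' ∧ k = k') (θ : Fin S → Fin N) {s : Fin S}
    {k : Fin N} {x : Fin d → ℝ} (hx : x ∈ box h (cellCenter b h (pos s k))) :
    bumpSum b h A (fun s => pos s (θ s)) x =
      if θ s = k then A * bump h (cellCenter b h (pos s k)) x else 0 := by
  have hz : ∀ s', ¬ (s' = s ∧ θ s' = k) →
      bump h (cellCenter b h (pos s' (θ s'))) x = 0 := by
    intro s' hs'
    by_contra hne
    exact hs' (hpos _ _ _ _ (eq_of_mem_box hh (mem_box_of_bump_ne_zero hh hne) hx))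
  rw [bumpSum_apply, Finset.sum_eq_single s]
  · split_ifs with hk
    · rw [hk]
    · rw [hz s fun h => hk h.2, mul_zero]
  · exact fun s' _ hs' => hz s' fun h => hs' h.1
  · simp

/-- The `L_p`-norm on the cube for `p < ∞`, and the largest absolute value at the centres of the
cells for `p = ∞`: a measurable minorant of `normLp`. -/
noncomputable def gridNorm (p : ℝ≥0∞) (b : ℝ) (h : Fin d → ℝ) (pos : Fin S → Fin N → Fin d → ℕ)
    (g : (Fin d → ℝ) → ℝ) : ℝ≥0∞ :=
  if p = ∞ then ⨆ s, ⨆ k, ENNReal.ofReal |g (cellCenter b h (pos s k))|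
  else eLpNorm g p (volume.restrict (cube d b))

theorem gridNorm_le_normLp (hh : ∀ j, 0 < h j) (hcb : ∀ s k j, (pos s k j + 1) * h j ≤ 2 * b)
    (p : ℝ≥0∞) (g : (Fin d → ℝ) → ℝ) : gridNorm p b h pos g ≤ normLp p (cube d b) g := by
  unfold gridNorm normLp
  split_ifs with hp
  · exact iSup₂_le fun s k => le_iSup₂_of_le (cellCenter b h (pos s k))
      (box_subset_cube hh (hcb s k) (center_mem_box hh)) le_rfl
  · exact le_rfl

/-- The integral bounds need measurability in the observation, which the supremum over an
uncountable cube does not obviously have. Finitely many centres suffice for `p = ∞`, since the bumps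
equal 1 there. -/
theorem measurable_gridNorm {Y : Type*} [MeasurableSpace Y] {p : ℝ≥0∞} (hp : 1 ≤ p)
    {g : Y → (Fin d → ℝ) → ℝ} (hg : Measurable (Function.uncurry g)) :
    Measurable fun y => gridNorm p b h pos (g y) := by
  unfold gridNorm
  split_ifs with h
  · refine Measurable.iSup fun s => Measurable.iSup fun k => ENNReal.measurable_ofReal.comp ?_
    exact (hg.comp (measurable_id.prodMk measurable_const)).abs
  · have hp0 : p ≠ 0 := (zero_lt_one.trans_le hp).ne'
    simp_rw [eLpNorm_eq_lintegral_rpow_enorm_toReal hp0 h]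
    refine Measurable.pow_const ?_ _
    exact (Measurable.pow_const hg.enorm p.toReal).lintegral_prod_right'

theorem gridNorm_sub_le {p : ℝ≥0∞} (hp : 1 ≤ p) {g g' : (Fin d → ℝ) → ℝ} (hg : Measurable g)
    (hg' : Measurable g') :
    gridNorm p b h pos (g - g') ≤ gridNorm p b h pos g + gridNorm p b h pos g' := by
  unfold gridNorm
  split_ifs with hp'
  · refine iSup₂_le fun s k => ?_
    calc ENNReal.ofReal |(g - g') (cellCenter b h (pos s k))|
        ≤ ENNReal.ofReal |g (cellCenter b h (pos s k))| +
          ENNReal.ofReal |g' (cellCenter b h (pos s k))| := by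
          rw [← ENNReal.ofReal_add (abs_nonneg _) (abs_nonneg _)]
          exact ENNReal.ofReal_le_ofReal (abs_sub _ _)
      _ ≤ _ := by
          gcongr
          · exact le_iSup₂_of_le (f := fun s k => ENNReal.ofReal |g (cellCenter b h (pos s k))|)
              s k le_rfl
          · exact le_iSup₂_of_le (f := fun s k => ENNReal.ofReal |g' (cellCenter b h (pos s k))|)
              s k le_rfl
  · exact eLpNorm_sub_le hg.aestronglyMeasurable hg'.aestronglyMeasurable hp

theorem hamming_le (θ θ' : Fin S → Fin N) : hamming θ θ' ≤ S :=
  (Finset.card_filter_le _ _).trans (by simp)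

/-- In a block where the words differ, the difference of the signals equals `A` on the half-size box
of the cell `θ s`. The proportion of such blocks appears to the power `1/p ≤ 1`; being at most 1, it
is dominated by that power, and a bound linear in the Hamming distance results. -/
theorem le_gridNorm_sub (hh : ∀ j, 0 < h j) (hA : 0 ≤ A)
    (hpos : ∀ s k s' k', pos s k = pos s' k' → s = s' ∧ k = k')
    (hcb : ∀ s k j, (pos s k j + 1) * h j ≤ 2 * b) (hS : 0 < S) {p : ℝ≥0∞} (hp : 1 ≤ p)
    (θ θ' : Fin S → Fin N) :
    ENNReal.ofReal (A * (S * ∏ j, (h j / 2)) ^ (p⁻¹).toReal) * (hamming θ θ' / S) ≤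
      gridNorm p b h pos
        (bumpSum b h A (fun s => pos s (θ s)) - bumpSum b h A (fun s => pos s (θ' s))) := by
  have hh2 : ∀ j, 0 < h j / 2 := fun j => half_pos (hh j)
  have hS' : (0 : ℝ) < S := by exact_mod_cast hS
  have hv : 0 ≤ ∏ j, (h j / 2) := Finset.prod_nonneg fun j _ => (hh2 j).le
  have hq0 : (0 : ℝ) ≤ hamming θ θ' / S := by positivity
  have hq1 : (hamming θ θ' : ℝ) / S ≤ 1 := by
    rw [div_le_one hS']; exact_mod_cast hamming_le θ θ'
  have hq : (hamming θ θ' / S : ℝ≥0∞) = ENNReal.ofReal (hamming θ θ' / S : ℝ) := by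
    rw [ENNReal.ofReal_div_of_pos hS']; simp
  rw [hq, ← ENNReal.ofReal_mul (by positivity)]
  have hone : ∀ s, θ s ≠ θ' s → ∀ x ∈ box (fun j => h j / 2) (cellCenter b h (pos s (θ s))),
      (bumpSum b h A (fun s => pos s (θ s)) - bumpSum b h A (fun s => pos s (θ' s))) x = A := by
    intro s hs x hx
    have hx' := box_half_subset hh hx
    rw [Pi.sub_apply, bumpSum_on_box hh hpos θ hx', bumpSum_on_box hh hpos θ' hx', if_pos rfl,
      if_neg hs.symm, bump_eq_one hh hx]
    ring
  unfold gridNorm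
  split_ifs with hp'
  · subst hp'
    simp only [ENNReal.inv_top, ENNReal.toReal_zero, Real.rpow_zero, mul_one]
    rcases Nat.eq_zero_or_pos (hamming θ θ') with h0 | h0
    · simp [h0]
    · obtain ⟨s, hs⟩ := Finset.card_pos.1 h0
      refine le_iSup₂_of_le s (θ s) (ENNReal.ofReal_le_ofReal ?_)
      rw [hone s (Finset.mem_filter.1 hs).2 _ (center_mem_box hh2), abs_of_nonneg hA]
      exact mul_le_of_le_one_right hA hq1
  · have hp0 : p ≠ 0 := (zero_lt_one.trans_le hp).ne'
    have hpi := toReal_inv_le_one hp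
    let D : Finset (Fin S) := Finset.univ.filter fun s => θ s ≠ θ' s
    let E : Set (Fin d → ℝ) := ⋃ s ∈ D, box (fun j => h j / 2) (cellCenter b h (pos s (θ s)))
    have hEm : MeasurableSet E := Finset.measurableSet_biUnion _ fun s _ => measurableSet_box _ _
    have hEc : E ⊆ cube d b := Set.iUnion₂_subset fun s _ =>
      (box_half_subset hh).trans (box_subset_cube hh (hcb s _))
    have hEv : volume.restrict (cube d b) E =
        ENNReal.ofReal (hamming θ θ' * ∏ j, (h j / 2)) := by
      rw [Measure.restrict_apply hEm, Set.inter_eq_left.2 hEc, measure_biUnion_finset]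
      · simp_rw [volume_box hh2]
        rw [ENNReal.ofReal_mul (by positivity)]
        simp [D, hamming]
      · intro s _ s' _ hss'
        refine Set.disjoint_left.2 fun x hx hx' => hss' ?_
        exact (hpos _ _ _ _ (eq_of_mem_box hh (box_half_subset hh hx) (box_half_subset hh hx'))).1
      · exact fun s _ => measurableSet_box _ _
    calc ENNReal.ofReal (A * (S * ∏ j, (h j / 2)) ^ (p⁻¹).toReal * (hamming θ θ' / S))
        ≤ ENNReal.ofReal (A * (hamming θ θ' * ∏ j, (h j / 2)) ^ (p⁻¹).toReal) := by
          refine ENNReal.ofReal_le_ofReal ?_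
          have e1 : (hamming θ θ' * ∏ j, (h j / 2) : ℝ) =
              (S * ∏ j, (h j / 2)) * (hamming θ θ' / S) := by field_simp
          rw [e1, Real.mul_rpow (by positivity) hq0, mul_assoc]
          gcongr
          rcases hq0.eq_or_lt with h0 | h0
          · rw [← h0]; exact Real.rpow_nonneg le_rfl _
          · calc (hamming θ θ' / S : ℝ) = (hamming θ θ' / S : ℝ) ^ (1 : ℝ) := (Real.rpow_one _).symm
              _ ≤ _ := Real.rpow_le_rpow_of_exponent_ge h0 hq1 hpi
      _ = eLpNorm (E.indicator fun _ => A) p (volume.restrict (cube d b)) := by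
          rw [eLpNorm_indicator_const hEm hp0 hp', hEv, Real.enorm_eq_ofReal hA,
            ENNReal.ofReal_rpow_of_nonneg (by positivity) (by positivity),
            ← ENNReal.ofReal_mul hA, ENNReal.toReal_inv, one_div]
      _ ≤ _ := by
          refine eLpNorm_mono fun x => ?_
          by_cases hx : x ∈ E
          · rw [Set.indicator_of_mem hx]
            obtain ⟨s, hs, hx⟩ := Set.mem_iUnion₂.1 hx
            rw [hone s (Finset.mem_filter.1 hs).2 x hx]
          · rw [Set.indicator_of_notMem hx]; simp

/-! ### The orthonormal system of normalized bumps -/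

theorem memLp_bump (hh : ∀ j, 0 < h j) (t : Fin d → ℝ) : MemLp (bump h t) 2 volume := by
  refine ⟨(continuous_bump h t).aestronglyMeasurable, ?_⟩
  have := normLp_univ_le (r := 2) (by norm_num) zero_le_one
    (Finset.prod_nonneg fun j _ => (hh j).le : 0 ≤ ∏ j, h j)
    (fun x => by rw [abs_of_nonneg (bump_nonneg h t x)]; exact bump_le_one h t x)
    (measurableSet_box h t) (fun x => mem_box_of_bump_ne_zero hh) (volume_box hh t).le
  rw [normLp, if_neg (by simp), Measure.restrict_univ] at this
  exact this.trans_lt ENNReal.ofReal_lt_top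

theorem integrable_bump_sq (hh : ∀ j, 0 < h j) (t : Fin d → ℝ) :
    Integrable fun x => bump h t x ^ 2 := (memLp_bump hh t).integrable_sq

/-- The squared `L_2`-norm of a bump. -/
noncomputable def bumpEnergy (h : Fin d → ℝ) : ℝ := ∫ x, bump h 0 x ^ 2

theorem integral_bump_sq (h t : Fin d → ℝ) : ∫ x, bump h t x ^ 2 = bumpEnergy h := by
  simp_rw [bump_eq_bump_zero h t]
  exact integral_sub_right_eq_self (fun x => bump h 0 x ^ 2) t

theorem bumpEnergy_le (hh : ∀ j, 0 < h j) : bumpEnergy h ≤ ∏ j, h j := by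
  have hV : 0 ≤ ∏ j, h j := Finset.prod_nonneg fun j _ => (hh j).le
  have hfin : volume (box h 0) ≠ ∞ := by rw [volume_box hh]; exact ENNReal.ofReal_ne_top
  calc bumpEnergy h ≤ ∫ x, (box h 0).indicator (fun _ => (1 : ℝ)) x := by
        refine integral_mono (integrable_bump_sq hh 0)
          ((integrable_indicator_iff (measurableSet_box h 0)).2 (integrableOn_const hfin)) fun x => ?_
        by_cases hx : x ∈ box h 0
        · rw [Set.indicator_of_mem hx]
          exact pow_le_one₀ (bump_nonneg _ _ _) (bump_le_one _ _ _)
        · rw [Set.indicator_of_notMem hx]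
          have : bump h 0 x = 0 := by
            by_contra h0; exact hx (mem_box_of_bump_ne_zero hh h0)
          simp [this]
    _ = ∏ j, h j := by
        rw [integral_indicator_const _ (measurableSet_box h 0), Measure.real, volume_box hh,
          ENNReal.toReal_ofReal hV, smul_eq_mul, mul_one]

theorem bumpEnergy_pos (hh : ∀ j, 0 < h j) : 0 < bumpEnergy h := by
  have hh2 : ∀ j, 0 < h j / 2 := fun j => half_pos (hh j)
  have hV : 0 < ∏ j, (h j / 2) := Finset.prod_pos fun j _ => hh2 j
  have hfin : volume (box (fun j => h j / 2) (0 : Fin d → ℝ)) ≠ ∞ := by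
    rw [volume_box hh2]; exact ENNReal.ofReal_ne_top
  calc 0 < ∏ j, (h j / 2) := hV
    _ = ∫ x, (box (fun j => h j / 2) (0 : Fin d → ℝ)).indicator (fun _ => (1 : ℝ)) x := by
        rw [integral_indicator_const _ (measurableSet_box _ 0), Measure.real, volume_box hh2,
          ENNReal.toReal_ofReal hV.le, smul_eq_mul, mul_one]
    _ ≤ bumpEnergy h := by
        refine integral_mono ((integrable_indicator_iff (measurableSet_box _ 0)).2
          (integrableOn_const hfin)) (integrable_bump_sq hh 0) fun x => ?_
        by_cases hx : x ∈ box (fun j => h j / 2) (0 : Fin d → ℝ)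
        · rw [Set.indicator_of_mem hx]
          simp [bump_eq_one hh hx]
        · rw [Set.indicator_of_notMem hx]
          exact sq_nonneg (bump h 0 x)

/-- The normalized bump with centre `t` as an element of `L_2`. -/
noncomputable def bumpUnit (hh : ∀ j, 0 < h j) (t : Fin d → ℝ) : TestSpace d :=
  (Real.sqrt (bumpEnergy h))⁻¹ • (memLp_bump hh t).toLp (bump h t)

theorem coeFn_bumpUnit (hh : ∀ j, 0 < h j) (t : Fin d → ℝ) :
    bumpUnit hh t =ᵐ[volume] fun x => (Real.sqrt (bumpEnergy h))⁻¹ * bump h t x := by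
  filter_upwards [Lp.coeFn_smul (Real.sqrt (bumpEnergy h))⁻¹ ((memLp_bump hh t).toLp (bump h t)),
    (memLp_bump hh t).coeFn_toLp] with x h1 h2
  rw [bumpUnit, h1, Pi.smul_apply, h2, smul_eq_mul]

theorem integral_mul_bumpUnit (hh : ∀ j, 0 < h j) (t : Fin d → ℝ) (g : TestSpace d) :
    ∫ x, g x * bumpUnit hh t x = (Real.sqrt (bumpEnergy h))⁻¹ * ∫ x, g x * bump h t x := by
  rw [← integral_const_mul]
  refine integral_congr_ae ?_
  filter_upwards [coeFn_bumpUnit hh t] with x hx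
  rw [hx]; ring

theorem integral_bumpUnit_mul_bumpUnit (hh : ∀ j, 0 < h j)
    (hpos : ∀ s k s' k', pos s k = pos s' k' → s = s' ∧ k = k') (s : Fin S) (k : Fin N)
    (s' : Fin S) (k' : Fin N) :
    ∫ x, bumpUnit hh (cellCenter b h (pos s k)) x * bumpUnit hh (cellCenter b h (pos s' k')) x =
      if s = s' ∧ k = k' then 1 else 0 := by
  rw [integral_mul_bumpUnit, integral_congr_ae (g := fun x => (Real.sqrt (bumpEnergy h))⁻¹ *
    (bump h (cellCenter b h (pos s k)) x * bump h (cellCenter b h (pos s' k')) x))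
    (by filter_upwards [coeFn_bumpUnit hh (cellCenter b h (pos s k))] with x hx; rw [hx]; ring),
    integral_const_mul]
  split_ifs with heq
  · obtain ⟨rfl, rfl⟩ := heq
    simp_rw [← sq]
    rw [integral_bump_sq, ← mul_assoc, ← mul_inv, Real.mul_self_sqrt (bumpEnergy_pos hh).le,
      inv_mul_cancel₀ (bumpEnergy_pos hh).ne']
  · have : ∀ x, bump h (cellCenter b h (pos s k)) x * bump h (cellCenter b h (pos s' k')) x = 0 := by
      intro x
      by_contra hne
      exact heq (hpos _ _ _ _ (eq_of_mem_box hh (mem_box_of_bump_ne_zero hh (left_ne_zero_of_mul hne))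
        (mem_box_of_bump_ne_zero hh (right_ne_zero_of_mul hne))))
    simp [this]

theorem integral_bumpSum_mul (hh : ∀ j, 0 < h j) {ε : ℝ} (hε : ε ≠ 0) (c : Fin S → Fin d → ℕ)
    (g : TestSpace d) :
    ∫ x, bumpSum b h A c x * g x = ε * ∑ s, A * Real.sqrt (bumpEnergy h) / ε *
      ∫ x, g x * bumpUnit hh (cellCenter b h (c s)) x := by
  have hsq : Real.sqrt (bumpEnergy h) ≠ 0 := (Real.sqrt_pos.2 (bumpEnergy_pos hh)).ne'
  simp_rw [integral_mul_bumpUnit, bumpSum_apply]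
  have : ∀ x, A * (∑ s, bump h (cellCenter b h (c s)) x) * g x =
      A * ∑ s, g x * bump h (cellCenter b h (c s)) x := by
    intro x
    rw [← Finset.mul_sum]; ring
  simp_rw [this]
  have hint : ∀ s, Integrable fun x => g x * bump h (cellCenter b h (c s)) x := fun s =>
    (Lp.memLp g).integrable_mul (memLp_bump hh _)
  rw [integral_const_mul, integral_finsetSum _ fun s _ => hint s, Finset.mul_sum, Finset.mul_sum]
  refine Finset.sum_congr rfl fun s _ => ?_
  field_simp

/-! ### The lower bound of the risk for given parameters of the construction -/

theorem lintegral_le_rpow {Ω : Type*} [MeasurableSpace Ω] (P : Measure Ω) [IsProbabilityMeasure P]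
    {q : ℝ} (hq : 1 ≤ q) {F : Ω → ℝ≥0∞} (hF : Measurable F) :
    ∫⁻ x, F x ∂P ≤ (∫⁻ x, F x ^ q ∂P) ^ (1 / q) := by
  have := eLpNorm'_le_eLpNorm'_of_exponent_le (f := F) zero_lt_one hq P hF.aestronglyMeasurable
  simpa [eLpNorm'] using this

/-- In units of `ε`, each active bump shifts its coordinate by `m = A * √(bumpEnergy h) / ε`. The
triangle inequality turns the separation of the signals into the hypothesis on pairs of losses, and
Jensen's inequality passes from the first moment to the `q`-th. -/
theorem iSup_risk_ge {Ω : Type*} [MeasurableSpace Ω] {P : Measure Ω} [IsProbabilityMeasure P]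
    {W : TestSpace d → Ω → ℝ} (hW : IsWhiteNoise W P) (hd : 0 < d) {q : ℝ} (hq : 1 ≤ q)
    {p : ℝ≥0∞} (hp : 1 ≤ p) {r : Fin d → ℝ≥0∞} (hr : ∀ j, 1 ≤ r j) {β L : Fin d → ℝ}
    (hβ : ∀ j, 0 < β j) {k : Fin d → ℕ} (hk : ∀ j, β j < k j) {C : Fin d → ℝ}
    (hC1 : ∀ j, 1 ≤ C j)
    (hC : ∀ j v y, |(fwdDiff v)^[k j] (bumpLine : ℝ → ℝ) y| ≤ C j * |v| ^ β j)
    (hh : ∀ j, 0 < h j) (hh1 : ∀ j, h j ≤ 1) (hA : 0 ≤ A) (hS : 0 < S) (hN : 0 < N)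
    (hpos : ∀ s k s' k', pos s k = pos s' k' → s = s' ∧ k = k')
    (hcb : ∀ s k j, (pos s k j + 1) * h j ≤ 2 * b)
    (hL : ∀ j, (k j + 1) ^ 2 * C j * (A * (S * ∏ i, h i) ^ ((r j)⁻¹).toReal) ≤ L j * h j ^ β j)
    {ε : ℝ} (hε : 0 < ε) (hexp : Real.exp (A ^ 2 * (∏ j, h j) / ε ^ 2) ≤ 3 / 4 * N)
    {T : Obs d → (Fin d → ℝ) → ℝ} (hT : IsEstimator p T) :
    ENNReal.ofReal (A * (S * ∏ j, (h j / 2)) ^ (p⁻¹).toReal) / 16 ≤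
      ⨆ f ∈ signals b p r β L, risk W P b p q ε T f := by
  let f : (Fin S → Fin N) → (Fin d → ℝ) → ℝ := fun θ => bumpSum b h A fun s => pos s (θ s)
  have hfm : ∀ θ, Measurable (f θ) := fun θ => (continuous_bumpSum _ _ _ _).measurable
  have hTm : ∀ X, Measurable (T X) := fun X => hT.1.comp measurable_prodMk_left
  let F : (Fin S → Fin N) → Obs d → ℝ≥0∞ := fun θ X => gridNorm p b h pos fun t => T X t - f θ t
  have hF : ∀ θ, Measurable (F θ) := fun θ =>
    measurable_gridNorm hp (g := fun X t => T X t - f θ t)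
      (hT.1.sub ((hfm θ).comp measurable_snd))
  have hm : Real.exp ((A * Real.sqrt (bumpEnergy h) / ε) ^ 2) ≤ 3 / 4 * N := by
    refine le_trans (Real.exp_le_exp.2 ?_) hexp
    rw [div_pow, mul_pow, Real.sq_sqrt (bumpEnergy_pos hh).le]
    gcongr
    exact bumpEnergy_le hh
  obtain ⟨θ, hθ⟩ := hW.exists_lintegral_ge hS hN
    (e := fun s k => bumpUnit hh (cellCenter b h (pos s k)))
    (integral_bumpUnit_mul_bumpUnit hh hpos) hm f
    (fun θ g => integral_bumpSum_mul hh hε.ne' (fun s => pos s (θ s)) g) F hF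
    (ENNReal.ofReal (A * (S * ∏ j, (h j / 2)) ^ (p⁻¹).toReal)) ENNReal.ofReal_ne_top
    (fun θ θ' X => by
      refine (le_gridNorm_sub hh hA hpos hcb hS hp θ θ').trans ?_
      have : f θ - f θ' = (fun t => T X t - f θ' t) - fun t => T X t - f θ t := by
        ext t; simp
      change gridNorm p b h pos (f θ - f θ') ≤ _
      rw [this, add_comm]
      exact gridNorm_sub_le hp ((hTm X).sub (hfm θ')) ((hTm X).sub (hfm θ)))
  have hinj : Function.Injective fun s => pos s (θ s) := fun s s' hs => (hpos _ _ _ _ hs).1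
  have hobs : Measurable (observation W ε (f θ)) := measurable_pi_lambda _ fun g =>
    ((hW.measurable g).const_mul ε).const_add _
  refine le_iSup₂_of_le (f θ) (bumpSum_mem_signals hd hh hh1 hA hinj (fun s j => hcb s _ j) hp hr hβ
    hk hC1 hC hL) (hθ.trans ((lintegral_le_rpow P hq ((hF θ).comp hobs)).trans ?_))
  unfold risk
  gcongr with x
  exact gridNorm_le_normLp hh hcb p _

end MinimaxNikolskii

/-! ### Reduction of the construction to two free parameters: height and active volume -/

namespace MinimaxNikolskii

universe u

variable {d : ℕ}

/-- For every white noise with values in `Type u`, no estimator has a maximal risk below `x`. -/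
def MinimaxBound (b : ℝ) (p : ℝ≥0∞) (q : ℝ) (r : Fin d → ℝ≥0∞) (β L : Fin d → ℝ) (ε x : ℝ) :
    Prop :=
  ∀ (Ω : Type u) [MeasurableSpace Ω] (P : Measure Ω) [IsProbabilityMeasure P]
    (W : TestSpace d → Ω → ℝ), IsWhiteNoise W P → ∀ T : Obs d → (Fin d → ℝ) → ℝ,
      IsEstimator p T → ENNReal.ofReal x ≤ ⨆ f ∈ signals b p r β L, risk W P b p q ε T f

theorem prod_rpow_side {D A σ : ℝ} (hD : 0 < D) (hA : 0 < A) (hσ : 0 < σ) (r : Fin d → ℝ≥0∞)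
    {β L : Fin d → ℝ} (hL : ∀ j, 0 < L j) :
    ∏ j, (D * A * σ ^ ((r j)⁻¹).toReal / L j) ^ (1 / β j) =
      (D * A) ^ invBeta β * σ ^ invOmega β r / prodL β L := by
  have hDA : 0 < D * A := mul_pos hD hA
  have h1 : ∀ j, (D * A * σ ^ ((r j)⁻¹).toReal / L j) ^ (1 / β j) =
      (D * A) ^ (1 / β j) * σ ^ (1 / β j * ((r j)⁻¹).toReal) / L j ^ (1 / β j) := by
    intro j
    have := Real.rpow_nonneg hσ.le ((r j)⁻¹).toReal
    rw [Real.div_rpow (by positivity) (hL j).le, Real.mul_rpow hDA.le this, ← Real.rpow_mul hσ.le,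
      mul_comm ((r j)⁻¹).toReal]
  simp_rw [h1]
  rw [Finset.prod_div_distrib, Finset.prod_mul_distrib, prodL, invBeta, invOmega,
    Real.rpow_sum_of_pos hDA, Real.rpow_sum_of_pos hσ]

/-- Since `h j ≤ b`, rounding `2 * b / h j` down leaves at least `b / h j` cells per edge, so at
least `b ^ d / ∏ h j` cells altogether; any injection into them will do. -/
theorem exists_grid_positions {b : ℝ} {h : Fin d → ℝ} (hh : ∀ j, 0 < h j) (hhb : ∀ j, h j ≤ b)
    {S N : ℕ} (hSN : (S : ℝ) * N * ∏ j, h j ≤ b ^ d) :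
    ∃ pos : Fin S → Fin N → Fin d → ℕ,
      (∀ s k s' k', pos s k = pos s' k' → s = s' ∧ k = k') ∧
      ∀ s k j, (pos s k j + 1) * h j ≤ 2 * b := by
  have hn : ∀ j, b / h j ≤ ⌊2 * b / h j⌋₊ := by
    intro j
    have h1 : 1 ≤ b / h j := (one_le_div (hh j)).2 (hhb j)
    have h2 := Nat.lt_floor_add_one (2 * b / h j)
    have h3 : 2 * b / h j = 2 * (b / h j) := by ring
    rw [h3] at h2 ⊢
    linarith
  have hcard : Fintype.card (Fin S × Fin N) ≤ Fintype.card (∀ j, Fin ⌊2 * b / h j⌋₊) := by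
    rw [Fintype.card_prod, Fintype.card_pi]
    simp only [Fintype.card_fin]
    have hV : 0 < ∏ j, h j := Finset.prod_pos fun j _ => hh j
    have : ((S * N : ℕ) : ℝ) ≤ ((∏ j, ⌊2 * b / h j⌋₊ : ℕ) : ℝ) := by
      push_cast
      calc (S : ℝ) * N ≤ b ^ d / ∏ j, h j := (le_div_iff₀ hV).2 hSN
        _ = ∏ j, b / h j := by rw [Finset.prod_div_distrib]; simp
        _ ≤ _ := Finset.prod_le_prod
          (fun j _ => div_nonneg ((hh j).le.trans (hhb j)) (hh j).le) fun j _ => hn j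
    exact_mod_cast this
  obtain ⟨φ⟩ := Function.Embedding.nonempty_of_card_le hcard
  refine ⟨fun s k j => φ (s, k) j, fun s k s' k' heq => ?_, fun s k j => ?_⟩
  · have : φ (s, k) = φ (s', k') := funext fun j => Fin.ext (congrFun heq j)
    simpa using φ.injective this
  · have h1 : ((φ (s, k) j : ℕ) : ℝ) + 1 ≤ ⌊2 * b / h j⌋₊ := by exact_mod_cast (φ (s, k) j).2
    have h2 : (⌊2 * b / h j⌋₊ : ℝ) ≤ 2 * b / h j :=
      Nat.floor_le (div_nonneg (by linarith [hh j, hhb j]) (hh j).le)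
    exact (le_div_iff₀ (hh j)).1 (h1.trans h2)

/-- The sides are the smallest that `hL` of `iSup_risk_ge` allows when the active volume is at most
`σ`. Then `S = ⌊σ / V⌋` and `N = ⌊b ^ d / σ⌋`, each rounding losing at most a factor 2. -/
theorem exists_minimaxBound (hd : 0 < d) {b : ℝ} (hb : 0 < b) {q : ℝ} (hq : 1 ≤ q) {p : ℝ≥0∞}
    (hp : 1 ≤ p) {β : Fin d → ℝ} (hβ : ∀ j, 0 < β j) {r : Fin d → ℝ≥0∞} (hr : ∀ j, 1 ≤ r j) :
    ∃ D η c : ℝ, 0 < D ∧ 0 < η ∧ 0 < c ∧ ∀ L : Fin d → ℝ, (∀ j, 0 < L j) → ∀ A σ ε : ℝ, 0 < A →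
      0 < σ → 0 < ε → σ ≤ b ^ d / 4 → (∀ j, A * σ ^ ((r j)⁻¹).toReal ≤ η * L j) →
      (D * A) ^ invBeta β * σ ^ invOmega β r / prodL β L ≤ σ →
      Real.exp (A ^ 2 * ((D * A) ^ invBeta β * σ ^ invOmega β r / prodL β L) / ε ^ 2) ≤
        3 * b ^ d / (8 * σ) →
      MinimaxBound.{u} b p q r β L ε (c * (A * σ ^ (p⁻¹).toReal)) := by
  have hex : ∀ j, ∃ k : ℕ, β j < k ∧ ∃ C : ℝ, 1 ≤ C ∧
      ∀ v y, |(fwdDiff v)^[k] (bumpLine : ℝ → ℝ) y| ≤ C * |v| ^ β j := fun j =>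
    (exists_nat_gt (β j)).imp fun k hk => ⟨hk, abs_fwdDiff_bumpLine_le (hβ j) hk⟩
  choose k hk C hC1 hC using hex
  have hC0 : ∀ j, 0 < C j := fun j => zero_lt_one.trans_le (hC1 j)
  have hDterm : ∀ j, 0 < ((k j : ℝ) + 1) ^ 2 * C j := fun j => mul_pos (by positivity) (hC0 j)
  have hne : (Finset.univ : Finset (Fin d)).Nonempty := ⟨⟨0, hd⟩, Finset.mem_univ _⟩
  set D : ℝ := ∑ j, ((k j : ℝ) + 1) ^ 2 * C j with hDdef
  have hD : 0 < D := Finset.sum_pos (fun j _ => hDterm j) hne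
  have hDj : ∀ j, ((k j : ℝ) + 1) ^ 2 * C j ≤ D := fun j =>
    Finset.single_le_sum (f := fun j => ((k j : ℝ) + 1) ^ 2 * C j) (fun i _ => (hDterm i).le)
      (Finset.mem_univ j)
  have hm0 : 0 < min 1 b := lt_min one_pos hb
  obtain ⟨j₀, -, hj₀⟩ := Finset.exists_min_image Finset.univ (fun j => (min 1 b) ^ β j) hne
  have hκ : 0 < (min 1 b) ^ β j₀ := Real.rpow_pos_of_pos hm0 _
  -- `η` is small enough to force every side below `min 1 b`. In the last constant, `2 ^ (-d)` comes
  -- from the half-size boxes, one more `1/2` from the rounding of `S`, and `1/16` from the Bayes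
  -- bound.
  refine ⟨D, (min 1 b) ^ β j₀ / D, (1 / 2) ^ (d + 1) / 16, hD, div_pos hκ hD, by positivity, ?_⟩
  intro L hL A σ ε hA hσ hε hσb hside hV hexp Ω _ P _ W hW T hT
  let h : Fin d → ℝ := fun j => (D * A * σ ^ ((r j)⁻¹).toReal / L j) ^ (1 / β j)
  have hbase : ∀ j, 0 < D * A * σ ^ ((r j)⁻¹).toReal / L j := fun j =>
    div_pos (mul_pos (mul_pos hD hA) (Real.rpow_pos_of_pos hσ _)) (hL j)
  have hh : ∀ j, 0 < h j := fun j => Real.rpow_pos_of_pos (hbase j) _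
  have hhβ : ∀ j, h j ^ β j = D * A * σ ^ ((r j)⁻¹).toReal / L j := by
    intro j
    simp only [h]
    rw [← Real.rpow_mul (hbase j).le, one_div, inv_mul_cancel₀ (hβ j).ne', Real.rpow_one]
  have hhm : ∀ j, h j ≤ min 1 b := by
    intro j
    refine (Real.rpow_le_rpow_iff (hh j).le hm0.le (hβ j)).1 ?_
    refine le_trans ?_ (hj₀ j (Finset.mem_univ j))
    rw [hhβ, div_le_iff₀ (hL j), mul_assoc]
    calc D * (A * σ ^ ((r j)⁻¹).toReal) ≤ D * ((min 1 b) ^ β j₀ / D * L j) :=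
          mul_le_mul_of_nonneg_left (hside j) hD.le
      _ = _ := by field_simp
  have hprod : ∏ j, h j = (D * A) ^ invBeta β * σ ^ invOmega β r / prodL β L :=
    prod_rpow_side hD hA hσ r hL
  rw [← hprod] at hV hexp
  set V : ℝ := ∏ j, h j with hVdef
  have hVpos : 0 < V := Finset.prod_pos fun j _ => hh j
  have hbd : 0 < b ^ d := by positivity
  have hfl : ∀ {x : ℝ}, 1 ≤ x → x / 2 ≤ ⌊x⌋₊ := by
    intro x hx
    have h1 := Nat.lt_floor_add_one x
    have h2 : (1 : ℝ) ≤ ⌊x⌋₊ := by exact_mod_cast Nat.one_le_floor_iff x |>.2 hx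
    linarith
  have hσV : 1 ≤ σ / V := (one_le_div hVpos).2 hV
  have hbσ : 1 ≤ b ^ d / σ := (one_le_div hσ).2 (by linarith)
  set S : ℕ := ⌊σ / V⌋₊
  set N : ℕ := ⌊b ^ d / σ⌋₊
  have hS : 0 < S := (Nat.one_le_floor_iff _).2 hσV
  have hN : 0 < N := (Nat.one_le_floor_iff _).2 hbσ
  have hS1 : (S : ℝ) ≤ σ / V := Nat.floor_le (by positivity)
  have hN1 : (N : ℝ) ≤ b ^ d / σ := Nat.floor_le (by positivity)
  have hSV : S * V ≤ σ := (le_div_iff₀ hVpos).1 hS1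
  have hSV2 : σ / 2 ≤ S * V := by
    have := mul_le_mul_of_nonneg_right (hfl hσV) hVpos.le
    have e : σ / V / 2 * V = σ / 2 := by field_simp
    rwa [e] at this
  obtain ⟨pos, hpos, hcb⟩ := exists_grid_positions (b := b) (S := S) (N := N) hh
    (fun j => (hhm j).trans (min_le_right _ _)) (by
      calc (S : ℝ) * N * V = S * V * N := by ring
        _ ≤ σ * (b ^ d / σ) := by gcongr
        _ = b ^ d := by field_simp)
  refine le_trans ?_ (iSup_risk_ge hW hd hq hp hr hβ hk hC1 hC hh
    (fun j => (hhm j).trans (min_le_left _ _)) hA.le hS hN hpos hcb ?_ hε ?_ hT)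
  · have h16 : (16 : ℝ≥0∞) = ENNReal.ofReal 16 := by simp
    rw [h16, ← ENNReal.ofReal_div_of_pos (by norm_num)]
    refine ENNReal.ofReal_le_ofReal ?_
    have hv : ∏ j, (h j / 2) = V * (1 / 2) ^ d := by
      rw [Finset.prod_div_distrib]; simp [V, div_eq_mul_inv]
    have hp1 := toReal_inv_le_one hp
    have h3 : σ ^ (p⁻¹).toReal * (1 / 2) ^ (d + 1) ≤ (S * ∏ j, (h j / 2)) ^ (p⁻¹).toReal := by
      calc σ ^ (p⁻¹).toReal * (1 / 2) ^ (d + 1)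
          ≤ σ ^ (p⁻¹).toReal * ((1 / 2) ^ (d + 1)) ^ (p⁻¹).toReal := by
            gcongr
            exact Real.self_le_rpow_of_le_one (by positivity)
              (pow_le_one₀ (by norm_num) (by norm_num)) hp1
        _ = (σ * (1 / 2) ^ (d + 1)) ^ (p⁻¹).toReal :=
            (Real.mul_rpow hσ.le (by positivity)).symm
        _ ≤ _ := by
            refine Real.rpow_le_rpow (by positivity) ?_ ENNReal.toReal_nonneg
            rw [hv, pow_succ]
            have : (0 : ℝ) < (1 / 2) ^ d := by positivity
            nlinarith
    nlinarith
  · intro j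
    rw [hhβ, mul_div_cancel₀ _ (hL j).ne', mul_assoc D]
    have h1 : (S * ∏ i, h i) ^ ((r j)⁻¹).toReal ≤ σ ^ ((r j)⁻¹).toReal :=
      Real.rpow_le_rpow (by positivity) hSV ENNReal.toReal_nonneg
    exact mul_le_mul (hDj j) (mul_le_mul_of_nonneg_left h1 hA.le) (by positivity) hD.le
  · refine hexp.trans ?_
    have := hfl hbσ
    calc 3 * b ^ d / (8 * σ) = 3 / 4 * (b ^ d / σ / 2) := by field_simp; norm_num
      _ ≤ _ := by gcongr

end MinimaxNikolskii

/-! ### Choice of height and active volume in each zone -/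

namespace MinimaxNikolskii

variable {d : ℕ}

/-- Heights `A` and active volumes `σ` for which the construction is possible at noise level `ε`. -/
structure Admissible (b D η : ℝ) (r : Fin d → ℝ≥0∞) (β L : Fin d → ℝ) (ε A σ : ℝ) : Prop where
  height_pos : 0 < A
  volume_pos : 0 < σ
  volume_le : σ ≤ b ^ d / 4
  side : ∀ j, A * σ ^ ((r j)⁻¹).toReal ≤ η * L j
  cell : (D * A) ^ invBeta β * σ ^ invOmega β r / prodL β L ≤ σ
  noise : Real.exp (A ^ 2 * ((D * A) ^ invBeta β * σ ^ invOmega β r / prodL β L) / ε ^ 2) ≤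
    3 * b ^ d / (8 * σ)

theorem invBeta_pos (hd : 0 < d) {β : Fin d → ℝ} (hβ : ∀ j, 0 < β j) : 0 < invBeta β :=
  Finset.sum_pos (fun j _ => one_div_pos.2 (hβ j)) ⟨⟨0, hd⟩, Finset.mem_univ _⟩

theorem invOmega_nonneg {β : Fin d → ℝ} (hβ : ∀ j, 0 < β j) (r : Fin d → ℝ≥0∞) :
    0 ≤ invOmega β r :=
  Finset.sum_nonneg fun j _ => mul_nonneg (one_div_pos.2 (hβ j)).le ENNReal.toReal_nonneg

theorem prodL_pos (β : Fin d → ℝ) {L : Fin d → ℝ} (hL : ∀ j, 0 < L j) : 0 < prodL β L :=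
  Finset.prod_pos fun j _ => Real.rpow_pos_of_pos (hL j) _

theorem prodL_mono {β : Fin d → ℝ} (hβ : ∀ j, 0 < β j) {L L' : Fin d → ℝ} (hL : ∀ j, 0 < L j)
    (hLL : ∀ j, L j ≤ L' j) : prodL β L ≤ prodL β L' :=
  Finset.prod_le_prod (fun j _ => (Real.rpow_pos_of_pos (hL j) _).le) fun j _ =>
    Real.rpow_le_rpow (hL j).le (hLL j) (one_div_pos.2 (hβ j)).le

/-! ### Limits at noise level zero -/

theorem eventually_pos_lt_one : ∀ᶠ ε in 𝓝[>] (0 : ℝ), 0 < ε ∧ ε < 1 :=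
  Ioo_mem_nhdsGT zero_lt_one

theorem tendsto_mul_abs_log : Tendsto (fun ε : ℝ => ε * |Real.log ε|) (𝓝[>] 0) (𝓝 0) := by
  have h := (tendsto_log_mul_rpow_nhdsGT_zero one_pos).abs
  rw [abs_zero] at h
  refine h.congr' ?_
  filter_upwards [self_mem_nhdsWithin] with ε hε
  rw [Real.rpow_one, abs_mul, abs_of_pos (Set.mem_Ioi.1 hε), mul_comm]

theorem tendsto_sq_mul_abs_log :
    Tendsto (fun ε : ℝ => ε ^ 2 * |Real.log ε|) (𝓝[>] 0) (𝓝 0) := by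
  have h1 : Tendsto (fun ε : ℝ => ε) (𝓝[>] 0) (𝓝 0) := tendsto_nhdsWithin_of_tendsto_nhds tendsto_id
  have h := h1.mul tendsto_mul_abs_log
  rw [mul_zero] at h
  refine h.congr fun ε => ?_
  ring

theorem tendsto_const_mul_rpow {l : Filter ℝ} {f : ℝ → ℝ} (hf : Tendsto f l (𝓝 0)) (M : ℝ) {e : ℝ}
    (he : 0 < e) : Tendsto (fun ε => M * f ε ^ e) l (𝓝 0) := by
  have h := (hf.rpow_const (p := e) (Or.inr he.le)).const_mul M
  rwa [Real.zero_rpow he.ne', mul_zero] at h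

/-- With `σ = M (ε² |ln ε|) ^ θ`, split `ε² = ε * ε`: one factor `ε ^ θ` cancels `exp (K |ln ε|) ≤ ε
^ (-θ)`, and the remaining `(ε |ln ε|) ^ θ` tends to 0 and absorbs the constants. -/
theorem exp_abs_log_le {ε K θ M v : ℝ} (hε : 0 < ε) (hε1 : ε < 1) (hKθ : K ≤ θ) (hM : 0 < M)
    (h : M * (ε * |Real.log ε|) ^ θ ≤ 3 * v / 8) :
    Real.exp (K * |Real.log ε|) ≤ 3 * v / (8 * (M * (ε ^ 2 * |Real.log ε|) ^ θ)) := by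
  have hlog : Real.log ε < 0 := Real.log_neg hε hε1
  have hl : 0 < |Real.log ε| := abs_pos.2 hlog.ne
  have hσ : 0 < M * (ε ^ 2 * |Real.log ε|) ^ θ := by positivity
  rw [le_div_iff₀ (by positivity)]
  have h1 : Real.exp (K * |Real.log ε|) ≤ ε ^ (-θ) := by
    rw [Real.rpow_def_of_pos hε, Real.exp_le_exp, abs_of_neg hlog]
    nlinarith
  have h2 : (ε ^ 2 * |Real.log ε|) ^ θ = (ε * |Real.log ε|) ^ θ * ε ^ θ := by
    rw [← Real.mul_rpow (by positivity) hε.le]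
    congr 1; ring
  have h3 : ε ^ (-θ) * ε ^ θ = 1 := by
    rw [← Real.rpow_add hε]; simp
  calc Real.exp (K * |Real.log ε|) * (8 * (M * (ε ^ 2 * |Real.log ε|) ^ θ))
      ≤ ε ^ (-θ) * (8 * (M * (ε ^ 2 * |Real.log ε|) ^ θ)) := by gcongr
    _ = 8 * (M * (ε * |Real.log ε|) ^ θ) * (ε ^ (-θ) * ε ^ θ) := by rw [h2]; ring
    _ ≤ 3 * v := by rw [h3]; linarith

/-! ### The zones -/

section Zones

variable {b D η L₀ : ℝ} {r : Fin d → ℝ≥0∞} {β : Fin d → ℝ}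

/-- With `σ` constant only the noise condition binds: `A ^ (2 + 1/β)` is proportional to `L_β ε²`.
The other conditions hold eventually since `A → 0`. -/
theorem admissible_dense (hb : 0 < b) (hD : 0 < D) (hη : 0 < η) (hL₀ : 0 < L₀)
    (hiβ : 0 < invBeta β) (x : ℝ) :
    ∃ c : ℝ, 0 < c ∧ ∀ L : Fin d → ℝ, (∀ j, L₀ ≤ L j) → ∀ᶠ ε in 𝓝[>] (0 : ℝ),
      ∃ A σ, Admissible b D η r β L ε A σ ∧
        c * (prodL β L * ε ^ 2) ^ (1 / (2 + invBeta β)) ≤ A * σ ^ x := by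
  set iβ := invBeta β
  have hbd : 0 < b ^ d := by positivity
  set σ : ℝ := b ^ d / 4 with hσdef
  have hσ : 0 < σ := by positivity
  have hσω : 0 < σ ^ invOmega β r := Real.rpow_pos_of_pos hσ _
  have hDβ : 0 < D ^ iβ := Real.rpow_pos_of_pos hD _
  have hlog : 0 < Real.log (3 / 2) := Real.log_pos (by norm_num)
  -- For `σ = b ^ d / 4` the right side of the noise condition is `3/2`; `a` makes that condition an
  -- equality.
  set a : ℝ := (Real.log (3 / 2) / (D ^ iβ * σ ^ invOmega β r)) ^ (1 / (2 + iβ)) with ha_def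
  have ha : 0 < a := Real.rpow_pos_of_pos (by positivity) _
  have haβ : a ^ (2 + iβ) = Real.log (3 / 2) / (D ^ iβ * σ ^ invOmega β r) := by
    rw [ha_def, ← Real.rpow_mul (by positivity), one_div, inv_mul_cancel₀ (by positivity),
      Real.rpow_one]
  refine ⟨a * σ ^ x, mul_pos ha (Real.rpow_pos_of_pos hσ _), fun L hL => ?_⟩
  have hL' : ∀ j, 0 < L j := fun j => hL₀.trans_le (hL j)
  have hΛ : 0 < prodL β L := prodL_pos β hL'
  set Λ := prodL β L
  have hδ : Tendsto (fun ε : ℝ => Λ * ε ^ 2) (𝓝[>] 0) (𝓝 0) := by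
    have : Tendsto (fun ε : ℝ => Λ * ε ^ 2) (𝓝 0) (𝓝 (Λ * 0 ^ 2)) :=
      Continuous.tendsto (by fun_prop) 0
    simpa using tendsto_nhdsWithin_of_tendsto_nhds this
  have hA0 : Tendsto (fun ε : ℝ => a * (Λ * ε ^ 2) ^ (1 / (2 + iβ))) (𝓝[>] 0) (𝓝 0) :=
    tendsto_const_mul_rpow hδ a (by positivity)
  have hev1 : ∀ᶠ ε in 𝓝[>] (0 : ℝ), ∀ j,
      a * (Λ * ε ^ 2) ^ (1 / (2 + iβ)) * σ ^ ((r j)⁻¹).toReal ≤ η * L j := by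
    refine eventually_all.2 fun j => ?_
    have := hA0.mul_const (σ ^ ((r j)⁻¹).toReal)
    rw [zero_mul] at this
    exact this.eventually_le_const (mul_pos hη (hL' j))
  have hev2 : ∀ᶠ ε in 𝓝[>] (0 : ℝ),
      (D * (a * (Λ * ε ^ 2) ^ (1 / (2 + iβ)))) ^ iβ * σ ^ invOmega β r / Λ ≤ σ := by
    have h1 := hA0.const_mul D
    rw [mul_zero] at h1
    have h2 := (tendsto_const_mul_rpow h1 (σ ^ invOmega β r / Λ) hiβ).eventually_le_const hσ
    filter_upwards [h2] with ε hε
    refine le_trans (le_of_eq ?_) hε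
    ring
  filter_upwards [hev1, hev2, eventually_pos_lt_one] with ε h1 h2 ⟨hε, _⟩
  have hδε : 0 < Λ * ε ^ 2 := by positivity
  have hA : 0 < a * (Λ * ε ^ 2) ^ (1 / (2 + iβ)) := mul_pos ha (Real.rpow_pos_of_pos hδε _)
  refine ⟨_, σ, ⟨hA, hσ, le_rfl, h1, h2, ?_⟩, le_of_eq (by ring)⟩
  set A := a * (Λ * ε ^ 2) ^ (1 / (2 + iβ)) with hAdef
  have hAβ : A ^ (2 + iβ) = a ^ (2 + iβ) * (Λ * ε ^ 2) := by
    rw [hAdef, Real.mul_rpow ha.le (by positivity), ← Real.rpow_mul hδε.le, one_div,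
      inv_mul_cancel₀ (by positivity), Real.rpow_one]
  have hA2 : A ^ 2 * A ^ iβ = A ^ (2 + iβ) := by
    rw [Real.rpow_add hA, Real.rpow_two]
  have hexp : A ^ 2 * ((D * A) ^ iβ * σ ^ invOmega β r / Λ) / ε ^ 2 = Real.log (3 / 2) := by
    rw [Real.mul_rpow hD.le hA.le]
    calc A ^ 2 * (D ^ iβ * A ^ iβ * σ ^ invOmega β r / Λ) / ε ^ 2
        = A ^ 2 * A ^ iβ * (D ^ iβ * σ ^ invOmega β r) / (Λ * ε ^ 2) := by
          field_simp
      _ = _ := by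
          rw [hA2, hAβ, haβ]
          field_simp
  rw [hexp, Real.exp_log (by norm_num), hσdef]
  refine le_of_eq ?_
  field_simp
  norm_num

/-- Write `u = ε² |ln ε|`. Requiring `V ≍ σ` and `A² σ ≍ u` gives `σ ^ t2 = u ^ (1/(2β)) / L_β` up
to a constant, which has a solution vanishing with `ε` because `t2 > 0`. -/
theorem admissible_sparse_one (hb : 0 < b) (hD : 0 < D) (hη : 0 < η) (hL₀ : 0 < L₀)
    (hiβ : 0 < invBeta β) {t2 x tx : ℝ} (ht2 : 0 < t2)
    (ht2' : t2 = 1 - invOmega β r + 1 / 2 * invBeta β)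
    (htr : ∀ j, 0 < tau β r (r j)) (htx : 0 < tx) (htx' : tx = 1 - invOmega β r + x * invBeta β) :
    ∃ c : ℝ, 0 < c ∧ ∀ L : Fin d → ℝ, (∀ j, L₀ ≤ L j) → ∀ᶠ ε in 𝓝[>] (0 : ℝ),
      ∃ A σ, Admissible b D η r β L ε A σ ∧
        c * (prodL β L ^ ((1 - 2 * x) / tx) * ε ^ 2 * |Real.log ε|) ^ (tx / (2 * t2)) ≤
          A * σ ^ x := by
  set iβ := invBeta β
  set iω := invOmega β r
  have hbd : 0 < b ^ d := by positivity
  set θ : ℝ := iβ / (2 * t2) with hθdef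
  have hθ : 0 < θ := by positivity
  -- The bound `1 / D` ensures `V ≤ σ`, and `√θ` ensures `a² ≤ θ` for the noise condition.
  set a : ℝ := min (1 / D) (Real.sqrt θ) with ha_def
  have ha : 0 < a := lt_min (by positivity) (Real.sqrt_pos.2 hθ)
  have haD : D * a ≤ 1 := by
    calc D * a ≤ D * (1 / D) := by gcongr; exact min_le_left _ _
      _ = 1 := by field_simp
  have ha2 : a ^ 2 ≤ θ := by
    calc a ^ 2 ≤ (Real.sqrt θ) ^ 2 := by gcongr; exact min_le_right _ _
      _ = θ := Real.sq_sqrt hθ.le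
  refine ⟨a, ha, fun L hL => ?_⟩
  have hL' : ∀ j, 0 < L j := fun j => hL₀.trans_le (hL j)
  have hΛ : 0 < prodL β L := prodL_pos β hL'
  set Λ := prodL β L
  set M : ℝ := Λ ^ (-1 / t2) with hMdef
  have hM : 0 < M := Real.rpow_pos_of_pos hΛ _
  -- This is `A σ^y`. With `y = 1 / r j` it yields the side conditions, as `τ(r j) > 0`; with `y =
  -- x` it is the rate.
  have hpow : ∀ y u : ℝ, 0 < u → a * Real.sqrt (u / (M * u ^ θ)) * (M * u ^ θ) ^ y =
      a * Λ ^ ((1 / 2 - y) / t2) * u ^ ((1 - iω + y * iβ) / (2 * t2)) := by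
    intro y u hu
    obtain ⟨μ, rfl⟩ : ∃ μ, u = Real.exp μ := ⟨Real.log u, (Real.exp_log hu).symm⟩
    obtain ⟨l, hl⟩ : ∃ l, Λ = Real.exp l := ⟨Real.log Λ, (Real.exp_log hΛ).symm⟩
    rw [hMdef, hl, hθdef]
    simp only [← Real.exp_mul, ← Real.exp_add, ← Real.exp_sub, ← Real.exp_half, mul_assoc]
    congr 2
    have : iω = 1 + 1 / 2 * iβ - t2 := by linarith
    rw [this]
    field_simp
    ring
  have hev1 : ∀ᶠ ε in 𝓝[>] (0 : ℝ), ∀ j, a * Λ ^ ((1 / 2 - ((r j)⁻¹).toReal) / t2) *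
      (ε ^ 2 * |Real.log ε|) ^ ((1 - iω + ((r j)⁻¹).toReal * iβ) / (2 * t2)) ≤ η * L j :=
    eventually_all.2 fun j => (tendsto_const_mul_rpow tendsto_sq_mul_abs_log _
      (div_pos (htr j) (by positivity))).eventually_le_const (mul_pos hη (hL' j))
  have hev2 := (tendsto_const_mul_rpow tendsto_mul_abs_log M hθ).eventually_le_const
    (show 0 < 3 * b ^ d / 8 by positivity)
  have hev3 := (tendsto_const_mul_rpow tendsto_sq_mul_abs_log M hθ).eventually_le_const
    (show 0 < b ^ d / 4 by positivity)
  filter_upwards [hev1, hev2, hev3, eventually_pos_lt_one] with ε h1 h2 h3 ⟨hε, hε1⟩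
  have hl : 0 < |Real.log ε| := abs_pos.2 (Real.log_neg hε hε1).ne
  set u : ℝ := ε ^ 2 * |Real.log ε| with hudef
  have hu : 0 < u := by positivity
  set σ : ℝ := M * u ^ θ with hσdef
  have hσ : 0 < σ := by positivity
  have hA : 0 < a * Real.sqrt (u / σ) := mul_pos ha (Real.sqrt_pos.2 (by positivity))
  have hcell : (D * (a * Real.sqrt (u / σ))) ^ iβ * σ ^ iω / Λ = (D * a) ^ iβ * σ := by
    obtain ⟨μ, hμ⟩ : ∃ μ, u = Real.exp μ := ⟨Real.log u, (Real.exp_log hu).symm⟩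
    obtain ⟨l, hl⟩ : ∃ l, Λ = Real.exp l := ⟨Real.log Λ, (Real.exp_log hΛ).symm⟩
    rw [← mul_assoc, Real.mul_rpow (by positivity) (by positivity), mul_assoc, mul_div_assoc]
    congr 1
    rw [hσdef, hMdef, hl, hθdef, hμ]
    simp only [← Real.exp_mul, ← Real.exp_add, ← Real.exp_sub, ← Real.exp_half]
    congr 1
    have : iω = 1 + 1 / 2 * iβ - t2 := by linarith
    rw [this]
    field_simp
    ring
  have hDa1 : (D * a) ^ iβ ≤ 1 := Real.rpow_le_one (by positivity) haD hiβ.le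
  refine ⟨_, σ, ⟨hA, hσ, h3, fun j => ?_, ?_, ?_⟩, ?_⟩
  · rw [hσdef, hpow _ u hu]; exact h1 j
  · rw [hcell]
    exact mul_le_of_le_one_left hσ.le hDa1
  · rw [hcell]
    refine le_trans (Real.exp_le_exp.2 ?_) (exp_abs_log_le hε hε1 ha2 hM h2)
    rw [mul_pow, Real.sq_sqrt (by positivity)]
    calc a ^ 2 * (u / σ) * ((D * a) ^ iβ * σ) / ε ^ 2
        = a ^ 2 * |Real.log ε| * (D * a) ^ iβ := by rw [hudef]; field_simp
      _ ≤ a ^ 2 * |Real.log ε| * 1 := by gcongr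
      _ = _ := mul_one _
  · rw [hσdef, hpow _ u hu, ← htx', mul_assoc, mul_assoc,
      Real.mul_rpow (Real.rpow_nonneg hΛ.le _) (by positivity), ← Real.rpow_mul hΛ.le]
    refine le_of_eq ?_
    congr 3
    field_simp

/-- When `s = 1/p*`, `A σ^s` is kept constant, and `s ≤ 1 / r j`, `σ ≤ 1` give the side conditions.
The volume `V` is proportional to `σ` to the power `1/ω - s/β ≥ 1`, which is where `τ(p*) ≤ 0`
enters. The lower bound `Λ₀` of `L_β` lets `a` be chosen independently of `L`. -/
theorem admissible_of_height (hD : 0 < D) {s a Λ₀ : ℝ} (ha : 0 < a) (hΛ₀ : 0 < Λ₀)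
    (hη : 0 < η) (hiβ : 0 < invBeta β) (hsr : ∀ j, s ≤ ((r j)⁻¹).toReal)
    (hτ : 1 - invOmega β r + s * invBeta β ≤ 0)
    (haD : D * a ≤ 1) (haΛ : (D * a) ^ invBeta β ≤ Λ₀) (haη : a ≤ η * L₀) {L : Fin d → ℝ}
    (hL : ∀ j, L₀ ≤ L j) (hΛ : Λ₀ ≤ prodL β L) {ε σ : ℝ} (hσ : 0 < σ) (hσ1 : σ ≤ 1)
    (hσb : σ ≤ b ^ d / 4)
    (hexp : Real.exp (a ^ 2 * (σ ^ (invOmega β r - (2 + invBeta β) * s) / prodL β L) / ε ^ 2) ≤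
      3 * b ^ d / (8 * σ)) :
    Admissible b D η r β L ε (a * σ ^ (-s)) σ := by
  set iβ := invBeta β
  set iω := invOmega β r
  set Λ := prodL β L
  have hΛp : 0 < Λ := hΛ₀.trans_le hΛ
  have hA : 0 < a * σ ^ (-s) := mul_pos ha (Real.rpow_pos_of_pos hσ _)
  have hDa : 0 < D * a := mul_pos hD ha
  have hcell : (D * (a * σ ^ (-s))) ^ iβ * σ ^ iω / Λ = (D * a) ^ iβ / Λ * σ ^ (iω - s * iβ) := by
    rw [← mul_assoc, Real.mul_rpow hDa.le (by positivity), ← Real.rpow_mul hσ.le, mul_assoc,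
      ← Real.rpow_add hσ]
    have : -s * iβ + iω = iω - s * iβ := by ring
    rw [this]; ring
  refine ⟨hA, hσ, hσb, fun j => ?_, ?_, le_trans (Real.exp_le_exp.2 ?_) hexp⟩
  · rw [mul_assoc, ← Real.rpow_add hσ]
    calc a * σ ^ (-s + ((r j)⁻¹).toReal) ≤ a * 1 := by
          gcongr
          exact Real.rpow_le_one hσ.le hσ1 (by linarith [hsr j])
      _ ≤ η * L₀ := by rw [mul_one]; exact haη
      _ ≤ η * L j := by gcongr; exact hL j
  · rw [hcell]
    calc (D * a) ^ iβ / Λ * σ ^ (iω - s * iβ) ≤ 1 * σ ^ (1 : ℝ) := by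
          refine mul_le_mul ?_ (Real.rpow_le_rpow_of_exponent_ge hσ hσ1 (by linarith))
            (by positivity) zero_le_one
          exact (div_le_one hΛp).2 (haΛ.trans hΛ)
      _ = σ := by rw [one_mul, Real.rpow_one]
  · rw [hcell]
    have h1 : (a * σ ^ (-s)) ^ 2 = a ^ 2 * σ ^ (-2 * s) := by
      rw [mul_pow, ← Real.rpow_natCast (σ ^ (-s)), ← Real.rpow_mul hσ.le]
      congr 2; push_cast; ring
    have h2 : σ ^ (-2 * s) * σ ^ (iω - s * iβ) = σ ^ (iω - (2 + iβ) * s) := by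
      rw [← Real.rpow_add hσ]; congr 1; ring
    have h3 : (a * σ ^ (-s)) ^ 2 * ((D * a) ^ iβ / Λ * σ ^ (iω - s * iβ)) =
        (D * a) ^ iβ * (a ^ 2 * (σ ^ (iω - (2 + iβ) * s) / Λ)) := by
      rw [h1, ← h2]; ring
    rw [h3]
    exact div_le_div_of_nonneg_right (mul_le_of_le_one_left (by positivity)
      (Real.rpow_le_one hDa.le haD hiβ.le)) (sq_nonneg ε)

theorem exists_height (D : ℝ) (hη : 0 < η) (hL₀ : 0 < L₀) {iβ Λ₀ K : ℝ} (hiβ : 0 < iβ)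
    (hΛ₀ : 0 < Λ₀) (hK : 0 < K) :
    ∃ a : ℝ, 0 < a ∧ D * a ≤ 1 ∧ (D * a) ^ iβ ≤ Λ₀ ∧ a ≤ η * L₀ ∧ a ^ 2 ≤ K := by
  have h0 : Tendsto (fun a : ℝ => a) (𝓝[>] 0) (𝓝 0) := tendsto_nhdsWithin_of_tendsto_nhds tendsto_id
  have h1 := h0.const_mul D
  rw [mul_zero] at h1
  have h2 := tendsto_const_mul_rpow h1 1 hiβ
  have h3 := h0.pow 2
  rw [zero_pow two_ne_zero] at h3
  obtain ⟨a, ha⟩ := ((h1.eventually_le_const one_pos).and ((h2.eventually_le_const hΛ₀).and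
    ((h0.eventually_le_const (mul_pos hη hL₀)).and ((h3.eventually_le_const hK).and
      eventually_pos_lt_one)))).exists
  obtain ⟨a1, a2, a3, a4, a5, -⟩ := ha
  exact ⟨a, a5, a1, by rwa [one_mul] at a2, a3, a4⟩

/-- The noise exponent is at most `a² σ^γ / (L_β ε²)`, so `σ^γ = L_β ε² |ln ε|` makes it at most `a²
|ln ε|`, and `a² ≤ 1 / γ` suffices. The bound is then `a σ^(x - s)`. -/
theorem admissible_sparse_many (hb : 0 < b) (hD : 0 < D) (hη : 0 < η) (hL₀ : 0 < L₀)
    (hβ : ∀ j, 0 < β j) (hiβ : 0 < invBeta β) {s x γ : ℝ} (hsr : ∀ j, s ≤ ((r j)⁻¹).toReal)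
    (hτ : 1 - invOmega β r + s * invBeta β ≤ 0) (hγ : 0 < γ)
    (hγ' : γ = invOmega β r - (2 + invBeta β) * s) :
    ∃ c : ℝ, 0 < c ∧ ∀ L : Fin d → ℝ, (∀ j, L₀ ≤ L j) → ∀ᶠ ε in 𝓝[>] (0 : ℝ),
      ∃ A σ, Admissible b D η r β L ε A σ ∧
        c * (prodL β L * ε ^ 2 * |Real.log ε|) ^ ((x - s) / γ) ≤ A * σ ^ x := by
  have hΛ₀ : 0 < prodL β fun _ => L₀ := prodL_pos β fun _ => hL₀
  obtain ⟨a, ha, haD, haΛ, haη, haK⟩ := exists_height D hη hL₀ hiβ hΛ₀ (one_div_pos.2 hγ)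
  refine ⟨a, ha, fun L hL => ?_⟩
  have hL' : ∀ j, 0 < L j := fun j => hL₀.trans_le (hL j)
  have hΛ : 0 < prodL β L := prodL_pos β hL'
  have hM : 0 < prodL β L ^ (1 / γ) := Real.rpow_pos_of_pos hΛ _
  have hγi : 0 < 1 / γ := one_div_pos.2 hγ
  have hev1 := (tendsto_const_mul_rpow tendsto_mul_abs_log (prodL β L ^ (1 / γ))
    hγi).eventually_le_const (show 0 < 3 * b ^ d / 8 by positivity)
  have hev2 := (tendsto_const_mul_rpow tendsto_sq_mul_abs_log (prodL β L ^ (1 / γ))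
    hγi).eventually_le_const (show 0 < min 1 (b ^ d / 4) from lt_min one_pos (by positivity))
  filter_upwards [hev1, hev2, eventually_pos_lt_one] with ε h1 h2 ⟨hε, hε1⟩
  have hl : 0 < |Real.log ε| := abs_pos.2 (Real.log_neg hε hε1).ne
  have hu : 0 < ε ^ 2 * |Real.log ε| := by positivity
  have hσeq : prodL β L ^ (1 / γ) * (ε ^ 2 * |Real.log ε|) ^ (1 / γ) =
      (prodL β L * (ε ^ 2 * |Real.log ε|)) ^ (1 / γ) := (Real.mul_rpow hΛ.le hu.le).symm
  have hy : 0 < prodL β L * (ε ^ 2 * |Real.log ε|) := mul_pos hΛ hu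
  set σ : ℝ := prodL β L ^ (1 / γ) * (ε ^ 2 * |Real.log ε|) ^ (1 / γ) with hσdef
  have hσ : 0 < σ := by positivity
  refine ⟨a * σ ^ (-s), σ, admissible_of_height hD ha hΛ₀ hη hiβ hsr hτ haD haΛ haη hL
    (prodL_mono hβ (fun _ => hL₀) hL) hσ (h2.trans (min_le_left _ _)) (h2.trans (min_le_right _ _))
    ?_, le_of_eq ?_⟩
  · rw [← hγ']
    have h3 : σ ^ γ = prodL β L * (ε ^ 2 * |Real.log ε|) := by
      rw [hσeq, ← Real.rpow_mul hy.le, one_div, inv_mul_cancel₀ hγ.ne', Real.rpow_one]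
    have h4 : a ^ 2 * (σ ^ γ / prodL β L) / ε ^ 2 = a ^ 2 * |Real.log ε| := by
      rw [h3]; field_simp
    rw [h4]
    exact exp_abs_log_le hε hε1 haK hM h1
  · rw [mul_assoc a, ← Real.rpow_add hσ, hσeq, ← Real.rpow_mul hy.le, ← mul_assoc]
    congr 2
    ring

/-- At fixed `ε` the noise exponent stays below a constant `K` for all `σ ≤ 1`, while the number of
candidate positions grows like `1 / σ`. A tiny `σ` therefore hides the signal, at no cost since `A
σ^s = a`. -/
theorem admissible_inconsistent (hb : 0 < b) (hD : 0 < D) (hη : 0 < η) (hL₀ : 0 < L₀)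
    (hβ : ∀ j, 0 < β j) (hiβ : 0 < invBeta β) {s : ℝ} (hsr : ∀ j, s ≤ ((r j)⁻¹).toReal)
    (hτ : 1 - invOmega β r + s * invBeta β ≤ 0)
    (hγ : 0 ≤ invOmega β r - (2 + invBeta β) * s) :
    ∃ c : ℝ, 0 < c ∧ ∀ L : Fin d → ℝ, (∀ j, L₀ ≤ L j) → ∀ ε : ℝ, 0 < ε →
      ∃ A σ, Admissible b D η r β L ε A σ ∧ c ≤ A * σ ^ s := by
  have hΛ₀ : 0 < prodL β fun _ => L₀ := prodL_pos β fun _ => hL₀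
  obtain ⟨a, ha, haD, haΛ, haη, -⟩ := exists_height D hη hL₀ hiβ hΛ₀ one_pos
  refine ⟨a, ha, fun L hL ε hε => ?_⟩
  have hΛ : 0 < prodL β L := prodL_pos β fun j => hL₀.trans_le (hL j)
  have hbd : 0 < b ^ d := by positivity
  set K : ℝ := a ^ 2 * (1 / prodL β L) / ε ^ 2
  set σ : ℝ := min (min 1 (b ^ d / 4)) (3 * b ^ d / (8 * Real.exp K)) with hσdef
  have hσ : 0 < σ := lt_min (lt_min one_pos (by positivity)) (by positivity)
  have hσ1 : σ ≤ 1 := (min_le_left _ _).trans (min_le_left _ _)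
  refine ⟨a * σ ^ (-s), σ, admissible_of_height hD ha hΛ₀ hη hiβ hsr hτ haD haΛ haη hL
    (prodL_mono hβ (fun _ => hL₀) hL) hσ hσ1 ((min_le_left _ _).trans (min_le_right _ _)) ?_, ?_⟩
  · have h1 : a ^ 2 * (σ ^ (invOmega β r - (2 + invBeta β) * s) / prodL β L) / ε ^ 2 ≤ K := by
      simp only [K]
      gcongr
      exact Real.rpow_le_one hσ.le hσ1 hγ
    refine (Real.exp_le_exp.2 h1).trans ?_
    have h2 : σ ≤ 3 * b ^ d / (8 * Real.exp K) := min_le_right _ _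
    rw [le_div_iff₀ (by positivity)] at h2 ⊢
    linarith
  · rw [mul_assoc, ← Real.rpow_add hσ]
    simp

end Zones

end MinimaxNikolskii

namespace MinimaxNikolskii

universe u

variable {d : ℕ}

/-! ### The conditions that delimit the zones -/

/-- Dividing by `ω` and `p` gives a real inequality in `1/p` and `1/ω` that also covers `p = ∞` and
`ω = ∞`. -/
theorem kappa_nonpos_iff (hd : 0 < d) {β : Fin d → ℝ} (hβ : ∀ j, 0 < β j) (r : Fin d → ℝ≥0∞)
    {p : ℝ≥0∞} (hp : 1 ≤ p) :
    kappa β r p ≤ 0 ↔ (2 + invBeta β) * (p⁻¹).toReal ≤ invOmega β r := by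
  have hiβ := invBeta_pos hd hβ
  have hiω := invOmega_nonneg hβ r
  unfold kappa omega
  rcases eq_or_ne p ∞ with rfl | hp'
  · simp [hiω, EReal.sub_top]
  have hp0 : 0 < p.toReal := ENNReal.toReal_pos (zero_lt_one.trans_le hp).ne' hp'
  have hpE : (p : EReal) = ((p.toReal : ℝ) : EReal) := by
    rw [EReal.coe_ennreal_toReal hp']
  rw [ENNReal.toReal_inv, hpE]
  rcases hiω.eq_or_lt with h0 | h0
  · rw [← h0]
    have h1 : ¬ ((2 + invBeta β) * (p.toReal)⁻¹ ≤ 0) := not_le.2 (by positivity)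
    simp only [ENNReal.ofReal_zero, ENNReal.inv_zero, EReal.coe_ennreal_top, h1, iff_false, not_le]
    rw [EReal.top_mul_coe_of_pos (by positivity), EReal.top_sub_coe]
    exact EReal.zero_lt_top
  · rw [← ENNReal.ofReal_inv_of_pos h0, EReal.coe_ennreal_ofReal, max_eq_left (by positivity),
      ← EReal.coe_mul, ← EReal.coe_sub, ← EReal.coe_zero, EReal.coe_le_coe_iff, sub_nonpos,
      inv_mul_le_iff₀ h0, ← div_eq_mul_inv, div_le_iff₀ hp0]

theorem toReal_inv_anti {x y : ℝ≥0∞} (hx : 1 ≤ x) (hxy : x ≤ y) :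
    (y⁻¹).toReal ≤ (x⁻¹).toReal :=
  ENNReal.toReal_mono (ENNReal.inv_ne_top.2 (zero_lt_one.trans_le hx).ne')
    (ENNReal.inv_le_inv.2 hxy)

theorem le_pstar (r : Fin d → ℝ≥0∞) (p : ℝ≥0∞) (j : Fin d) : r j ≤ pstar r p :=
  (le_iSup r j).trans le_sup_left

theorem omega_toReal {β : Fin d → ℝ} (hβ : ∀ j, 0 < β j) (r : Fin d → ℝ≥0∞) :
    (omega β r).toReal = (invOmega β r)⁻¹ := by
  rw [omega, ENNReal.toReal_inv, ENNReal.toReal_ofReal (invOmega_nonneg hβ r)]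

theorem tau_two (β : Fin d → ℝ) (r : Fin d → ℝ≥0∞) :
    tau β r 2 = 1 - invOmega β r + 1 / 2 * invBeta β := by
  simp [tau]

theorem sparseExponent_eq {β : Fin d → ℝ} (hβ : ∀ j, 0 < β j) (r : Fin d → ℝ≥0∞)
    {p : ℝ≥0∞} (hp : 1 ≤ p) (hpp : p < pstar r p) (hω : 0 < invOmega β r)
    (hγ : 0 < invOmega β r - (2 + invBeta β) * ((pstar r p)⁻¹).toReal) :
    sparseExponent β r p = ((p⁻¹).toReal - ((pstar r p)⁻¹).toReal) /
      (invOmega β r - (2 + invBeta β) * ((pstar r p)⁻¹).toReal) := by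
  have hp0 : 0 < p.toReal := ENNReal.toReal_pos (zero_lt_one.trans_le hp).ne' hpp.ne_top
  unfold sparseExponent
  rw [omega_toReal hβ]
  split_ifs with h
  · rw [h]
    simp only [ENNReal.inv_top, ENNReal.toReal_zero, sub_zero, mul_zero, ENNReal.toReal_inv]
    field_simp
  · rw [ENNReal.toReal_inv] at hγ ⊢
    rw [ENNReal.toReal_inv]
    have hP0 : 0 < (pstar r p).toReal :=
      ENNReal.toReal_pos (zero_lt_one.trans_le (hp.trans hpp.le)).ne' h
    set P := (pstar r p).toReal
    have e : invOmega β r - (2 + invBeta β) * P⁻¹ =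
        invOmega β r / P * (P - (invOmega β r)⁻¹ * (2 + invBeta β)) := by
      field_simp
    have hne : P - (invOmega β r)⁻¹ * (2 + invBeta β) ≠ 0 := by
      intro h0
      rw [e, h0, mul_zero] at hγ
      exact lt_irrefl _ hγ
    rw [e]
    field_simp

/-! ### The lower bound at small noise levels -/

theorem MinimaxBound.mono {b : ℝ} {p : ℝ≥0∞} {q : ℝ} {r : Fin d → ℝ≥0∞} {β L : Fin d → ℝ}
    {ε x y : ℝ} (h : MinimaxBound.{u} b p q r β L ε x) (hyx : y ≤ x) :
    MinimaxBound.{u} b p q r β L ε y := fun Ω _ P _ W hW T hT =>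
  (ENNReal.ofReal_le_ofReal hyx).trans (h Ω P W hW T hT)

theorem minimaxBound_rate (hd : 0 < d) {b : ℝ} (hb : 0 < b) {q : ℝ} (hq : 1 ≤ q) {L₀ : ℝ}
    (hL₀ : 0 < L₀) {p : ℝ≥0∞} (hp : 1 ≤ p) {β : Fin d → ℝ} (hβ : ∀ j, 0 < β j)
    {r : Fin d → ℝ≥0∞} (hr : ∀ j, 1 ≤ r j) :
    ∃ c : ℝ, 0 < c ∧ ∀ L : Fin d → ℝ, (∀ j, L₀ ≤ L j) → ∀ᶠ ε in 𝓝[>] (0 : ℝ),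
      MinimaxBound.{u} b p q r β L ε (c * rateBase β r L p ε ^ rateExponent β r p) := by
  obtain ⟨D, η, c₀, hD, hη, hc₀, hcore⟩ := exists_minimaxBound.{u} hd hb hq hp hβ hr
  have hiβ := invBeta_pos hd hβ
  suffices hadm : ∃ c : ℝ, 0 < c ∧ ∀ L : Fin d → ℝ, (∀ j, L₀ ≤ L j) → ∀ᶠ ε in 𝓝[>] (0 : ℝ),
      ∃ A σ, Admissible b D η r β L ε A σ ∧
        c * rateBase β r L p ε ^ rateExponent β r p ≤ A * σ ^ (p⁻¹).toReal by
    obtain ⟨c, hc, H⟩ := hadm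
    refine ⟨c₀ * c, mul_pos hc₀ hc, fun L hL => ?_⟩
    filter_upwards [H L hL, eventually_pos_lt_one] with ε ⟨A, σ, hA, hle⟩ ⟨hε, _⟩
    refine (hcore L (fun j => hL₀.trans_le (hL j)) A σ ε hA.height_pos hA.volume_pos hε
      hA.volume_le hA.side hA.cell hA.noise).mono ?_
    rw [mul_assoc]
    exact mul_le_mul_of_nonneg_left hle hc₀.le
  unfold rateBase rateExponent
  by_cases hκ : 0 < kappa β r p
  · simp only [hκ, if_true]
    have e : 1 / invBeta β / (2 * (1 / invBeta β) + 1) = 1 / (2 + invBeta β) := by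
      field_simp
    rw [e]
    exact admissible_dense hb hD hη hL₀ hiβ _
  have hκ' := (kappa_nonpos_iff hd hβ r hp).1 (not_lt.1 hκ)
  have hs : ((pstar r p)⁻¹).toReal ≤ (p⁻¹).toReal := toReal_inv_anti hp le_sup_right
  have hsr : ∀ j, ((pstar r p)⁻¹).toReal ≤ ((r j)⁻¹).toReal := fun j =>
    toReal_inv_anti (hr j) (le_pstar r p j)
  simp only [hκ, if_false]
  by_cases hτ : 0 < tau β r (pstar r p)
  · simp only [hτ, if_true]
    -- The condition `κ(p) ≤ 0` is equivalent to `(2 + 1/β) τ(p) ≤ 2 τ(2)`, and `τ(p) ≥ τ(p*) > 0`.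
    have hτ2 : 0 < tau β r 2 := by
      rw [tau_two]
      unfold tau at hτ
      have h1 : ((pstar r p)⁻¹).toReal * invBeta β ≤ (p⁻¹).toReal * invBeta β := by gcongr
      have h2 : (2 + invBeta β) * (1 - invOmega β r + (p⁻¹).toReal * invBeta β) ≤
          2 * (1 - invOmega β r + 1 / 2 * invBeta β) := by nlinarith
      have h3 : 0 < (2 + invBeta β) * (1 - invOmega β r + (p⁻¹).toReal * invBeta β) :=
        mul_pos (by positivity) (by linarith)
      linarith
    have hτmono : ∀ {y : ℝ≥0∞}, ((pstar r p)⁻¹).toReal ≤ (y⁻¹).toReal → 0 < tau β r y := by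
      intro y hy
      refine hτ.trans_le ?_
      unfold tau
      gcongr
    exact admissible_sparse_one hb hD hη hL₀ hiβ hτ2 (tau_two β r) (fun j => hτmono (hsr j))
      (hτmono hs) rfl
  simp only [hτ, if_false]
  have hτ' : 1 - invOmega β r + ((pstar r p)⁻¹).toReal * invBeta β ≤ 0 := not_lt.1 hτ
  by_cases hpp : p < pstar r p
  · simp only [hpp, if_true]
    have hslt : ((pstar r p)⁻¹).toReal < (p⁻¹).toReal := by
      refine (ENNReal.toReal_lt_toReal ?_ ?_).2 (ENNReal.inv_lt_inv.2 hpp)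
      · exact ENNReal.inv_ne_top.2 ((zero_lt_one.trans_le hp).trans hpp).ne'
      · exact ENNReal.inv_ne_top.2 (zero_lt_one.trans_le hp).ne'
    have hγ : 0 < invOmega β r - (2 + invBeta β) * ((pstar r p)⁻¹).toReal := by
      have : (2 + invBeta β) * ((pstar r p)⁻¹).toReal < (2 + invBeta β) * (p⁻¹).toReal := by gcongr
      linarith
    have hω : 0 < invOmega β r := by
      have : 0 ≤ (2 + invBeta β) * ((pstar r p)⁻¹).toReal := by positivity
      linarith
    rw [sparseExponent_eq hβ r hp hpp hω hγ]
    exact admissible_sparse_many hb hD hη hL₀ hβ hiβ hsr hτ' hγ rfl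
  · have hpe : pstar r p = p := le_antisymm (not_lt.1 hpp) le_sup_right
    rw [hpe] at hsr hτ'
    obtain ⟨c, hc, H⟩ := admissible_inconsistent (b := b) hb hD hη hL₀ hβ hiβ hsr hτ'
      (sub_nonneg.2 hκ')
    refine ⟨c, hc, fun L hL => ?_⟩
    filter_upwards [eventually_pos_lt_one] with ε ⟨hε, _⟩
    simpa [hpp] using H L hL ε hε

theorem rateBase_pos {β L : Fin d → ℝ} (r : Fin d → ℝ≥0∞) (hL : ∀ j, 0 < L j) (p : ℝ≥0∞) {ε : ℝ}
    (hε : 0 < ε) (hε1 : ε < 1) : 0 < rateBase β r L p ε := by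
  have hΛ := prodL_pos β hL
  have hl : 0 < |Real.log ε| := abs_pos.2 (Real.log_neg hε hε1).ne
  unfold rateBase
  split_ifs <;> positivity

/-- The exponent of the rate vanishes in the zone without uniformly consistent estimators. -/
theorem rateExponent_eq_zero (hd : 0 < d) {p : ℝ≥0∞} (hp : 1 ≤ p) {β : Fin d → ℝ}
    (hβ : ∀ j, 0 < β j) {r : Fin d → ℝ≥0∞} (hpr : pstar r p = p)
    (h : (2 ≤ p ∧ tau β r p ≤ 0) ∨ (p < 2 ∧ kappa β r p ≤ 0)) : rateExponent β r p = 0 := by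
  have hiβ := invBeta_pos hd hβ
  -- The two conditions read `1/ω ≥ 2/p + 1/(pβ)` and `1/ω ≥ 1 + 1/(pβ)`. Which one implies the
  -- other depends on whether `2/p` exceeds 1.
  have hκτ : kappa β r p ≤ 0 ∧ tau β r p ≤ 0 := by
    rcases h with ⟨h2, hτ⟩ | ⟨h2, hκ⟩
    · refine ⟨(kappa_nonpos_iff hd hβ r hp).2 ?_, hτ⟩
      have h3 := toReal_inv_anti (by norm_num) h2
      have h4 : ((2 : ℝ≥0∞)⁻¹).toReal = 1 / 2 := by simp
      rw [h4] at h3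
      unfold tau at hτ
      linarith
    · refine ⟨hκ, ?_⟩
      have h3 := toReal_inv_anti hp h2.le
      have h4 : ((2 : ℝ≥0∞)⁻¹).toReal = 1 / 2 := by simp
      rw [h4] at h3
      have h5 := (kappa_nonpos_iff hd hβ r hp).1 hκ
      unfold tau
      linarith
  unfold rateExponent
  rw [if_neg (not_lt.2 hκτ.1), hpr, if_neg (not_lt.2 hκτ.2), if_neg (lt_irrefl p)]

end MinimaxNikolskii

/-! ### The theorem -/

theorem theorem2 (d : ℕ) (hd : 0 < d) (b : ℝ) (hb : 0 < b) (q : ℝ) (hq : 1 ≤ q)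
    (L₀ : ℝ) (hL₀ : 0 < L₀) (p : ℝ≥0∞) (hp : 1 ≤ p)
    (β : Fin d → ℝ) (hβ : ∀ j, 0 < β j) (r : Fin d → ℝ≥0∞) (hr : ∀ j, 1 ≤ r j) :
    -- the lower bound of the minimax risk, with a constant that does not depend on `L`
    (∃ c : ℝ, 0 < c ∧ ∀ L : Fin d → ℝ, (∀ j, L₀ ≤ L j) →
      ∀ (Ω : Type*) [MeasurableSpace Ω] (P : Measure Ω) [IsProbabilityMeasure P]
        (W : MinimaxNikolskii.TestSpace d → Ω → ℝ), MinimaxNikolskii.IsWhiteNoise W P →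
        ENNReal.ofReal c ≤ liminf (fun ε : ℝ =>
          ⨅ (T : MinimaxNikolskii.Obs d → (Fin d → ℝ) → ℝ) (_ : MinimaxNikolskii.IsEstimator p T),
            ⨆ f ∈ MinimaxNikolskii.signals b p r β L,
              ENNReal.ofReal (MinimaxNikolskii.rateBase β r L p ε ^
                (-MinimaxNikolskii.rateExponent β r p)) *
                MinimaxNikolskii.risk W P b p q ε T f) (𝓝[>] (0 : ℝ))) ∧
    -- the absence of uniformly consistent estimators
    (MinimaxNikolskii.pstar r p = p →
      ((2 ≤ p ∧ MinimaxNikolskii.tau β r p ≤ 0) ∨ (p < 2 ∧ MinimaxNikolskii.kappa β r p ≤ 0)) →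
      ∀ L : Fin d → ℝ, (∀ j, L₀ ≤ L j) →
      ∀ (Ω : Type*) [MeasurableSpace Ω] (P : Measure Ω) [IsProbabilityMeasure P]
        (W : MinimaxNikolskii.TestSpace d → Ω → ℝ), MinimaxNikolskii.IsWhiteNoise W P →
        ¬ ∃ T : ℝ → MinimaxNikolskii.Obs d → (Fin d → ℝ) → ℝ,
          (∀ ε, MinimaxNikolskii.IsEstimator p (T ε)) ∧
          Tendsto (fun ε : ℝ => ⨆ f ∈ MinimaxNikolskii.signals b p r β L,
            MinimaxNikolskii.risk W P b p q ε (T ε) f) (𝓝[>] (0 : ℝ)) (𝓝 0)) := by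
  refine ⟨?_, ?_⟩
  · obtain ⟨c, hc, H⟩ := MinimaxNikolskii.minimaxBound_rate hd hb hq hL₀ hp hβ hr
    refine ⟨c, hc, fun L hL Ω _ P _ W hW => le_liminf_of_le (by isBoundedDefault) ?_⟩
    filter_upwards [H L hL, MinimaxNikolskii.eventually_pos_lt_one] with ε hε ⟨h0, h1⟩
    have hpos := MinimaxNikolskii.rateBase_pos (β := β) (L := L) r (fun j => hL₀.trans_le (hL j)) p
      h0 h1
    refine le_iInf₂ fun T hT => ?_
    simp_rw [← ENNReal.mul_iSup]
    calc ENNReal.ofReal c = ENNReal.ofReal (MinimaxNikolskii.rateBase β r L p ε ^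
          (-MinimaxNikolskii.rateExponent β r p)) *
          ENNReal.ofReal (c * MinimaxNikolskii.rateBase β r L p ε ^
            MinimaxNikolskii.rateExponent β r p) := by
          rw [← ENNReal.ofReal_mul (by positivity), mul_left_comm, ← Real.rpow_add hpos]
          simp
      _ ≤ _ := by
          gcongr
          exact hε Ω P W hW T hT
  · rintro hpr hcase L hL Ω _ P _ W hW ⟨T, hT, hlim⟩
    obtain ⟨c, hc, H⟩ := MinimaxNikolskii.minimaxBound_rate hd hb hq hL₀ hp hβ hr
    have h0 := MinimaxNikolskii.rateExponent_eq_zero hd hp hβ hpr hcase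
    -- As the exponent is zero, the bound at small `ε` is the constant `c`, which a vanishing
    -- maximal risk contradicts at a single `ε`.
    obtain ⟨ε, hlt, hε⟩ := ((hlim.eventually_lt_const (ENNReal.ofReal_pos.2 hc)).and (H L hL)).exists
    have := hε Ω P W hW (T ε) (hT ε)
    rw [h0, Real.rpow_zero, mul_one] at this
    exact absurd hlt (not_lt.2 this)
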